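/- **Setting.** Let $\mathbb{R}_{\mathfrak s}=\{t-,t+ : t\in\mathbb{R}\}$ be the split real line with the lexicographic order ($t-<t+$) and its order topology. A càdlàg path $f$ consists of a closed interval $I(f)=[\sigma_f,\tau_f]\subseteq[-\infty,\infty]$ and a continuous function $t\star\mapsto f(t\star)\in[-\infty,\infty]$ on $\{t\star\in\mathbb{R}_{\mathfrak s}: t\in I(f)\}$; no values are recorded at times $\pm\infty$. Let $\Pi$ be the set of such paths, $\Pi^\uparrow=\{f:\tau_f=\infty\}$ and $\Pi^\updownarrow=\{f:\sigma_f=-\infty,\ \tau_f=\infty\}$. Let $\mathbb{R}^2_{\rm c}=([-\infty,\infty]\times\mathbb{R})\cup\{(*,-\infty),(*,\infty)\}$ be $[-\infty,\infty]\times[-\infty,\infty]$ (space $\times$ time) with each of the time slices $t=-\infty$ and $t=\infty$ collapsed to a point, with the quotient topology. The interpolated graph $H(f)\subseteq\mathbb{R}^2_{\rm c}$ is the set of $(x,t)$ with $t\in I(f)$ and $x$ between $f(t-)$ and $f(t+)$ (the point $(*,t)$ if $t=\pm\infty$). Write $(x_1,t_1)\sqsubseteq(x_2,t_2)$ for points of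 $H(f)$ if $t_1<t_2$, or $t_1=t_2$ and $x_1$ is at least as close to $f(t_1-)$ as $x_2$, and let $H^{(2)}(f)=\{(z_1,z_2)\in H(f)^2: z_1\sqsubseteq z_2\}$. The M1 topology on $\Pi$ is the one induced by $f\mapsto H^{(2)}(f)$ from the Hausdorff topology on compact subsets of $(\mathbb{R}^2_{\rm c})^2$. The path $g$ extends $f$, written $f\subseteq g$, if $H^{(2)}(f)\subseteq H^{(2)}(g)$. Write $f\vartriangleleft g$ if there are $f',g'\in\Pi^\updownarrow$ with $f\subseteq f'$, $g\subseteq g'$ and $f'(t\star)\le g'(t\star)$ for all $t\star\in\mathbb{R}_{\mathfrak s}$; paths $f,g$ are non-crossing if $f\vartriangleleft g$ or $g\vartriangleleft f$. A deterministic weave is a compact set $\mathcal{A}\subseteq\Pi^\uparrow$ whose elements are pairwise non-crossing and such that every $z\in\mathbb{R}^2_{\rm c}$ lies in $H(f)$ for some $f\in\mathcal{A}$. Let $\mathcal{A}_{\max}$ be the set of maximal elements of $(\mathcal{A},\subseteq)$, and let $\mathrm{flow}(\mathcal{A})$ be the set of $h\in\Pi^\updownarrow$ that do not cross any element of $\mathcal{A}$.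 A Dedekind cut of $\mathcal{A}_{\max}$ is a subset $X\subseteq\mathcal{A}_{\max}$ such that (i) if $f,g\in\mathcal{A}_{\max}$, $f\vartriangleleft g$ and $g\in X$, then $f\in X$; and (ii) $X$ has no maximal element with respect to $\vartriangleleft$. For $h\in\Pi^\uparrow$ let $$X_h=\{f\in\mathcal{A}_{\max}: f\vartriangleleft h,\ f\not\subseteq h,\ h\not\subseteq f\}.$$ For $f\in\Pi^\uparrow$ let $L(f)\subseteq[-\infty,\infty]\times\mathbb{R}_{\mathfrak s}$ be the set of $(x,t\star)$ with $x<f(t\star)$ and either $t\star\ge\sigma_f+$, or $t\star=\sigma_f-$ and $f(\sigma_f+)<f(\sigma_f-)$. For a Dedekind cut $X$ let $$\mathscr{P}_X(t\star)=\sup\Big\{x\in[-\infty,\infty] : (x,t\star)\in\overline{\textstyle\bigcup_{f\in X}L(f)}\Big\},\qquad t\star\in\mathbb{R}_{\mathfrak s},$$ with the closure in the product space $[-\infty,\infty]\times\mathbb{R}_{\mathfrak s}$ and $\sup\emptyset=-\infty$. **Theorem.** Let $\mathcal{A}$ be a deterministic weave. 1. The map $h\mapsto X_h$ is a bijection from $\mathrm{flow}(\mathcal{A})$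 onto the set of Dedekind cuts of $\mathcal{A}_{\max}$. For each Dedekind cut $X$ the function $\mathscr{P}_X$ is a path in $\mathrm{flow}(\mathcal{A})$, and $X\mapsto\mathscr{P}_X$ is the inverse map. 2. For every $f\in\Pi^\uparrow$ that does not cross any element of $\mathcal{A}$ there exists $h\in\mathrm{flow}(\mathcal{A})$ with $f\subseteq h$. -/

import Mathlib

open Set Topology

/-- The split real line: each real time `t` is split into `t-` (second coordinate `false`) and
`t+` (second coordinate `true`), ordered lexicographically. -/
def SplitReal : Type := ℝ ×ₗ Bool

noncomputable instance : LinearOrder SplitReal := inferInstanceAs (LinearOrder (ℝ ×ₗ Bool))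

/-- The split real line carries its order topology. -/
noncomputable instance : TopologicalSpace SplitReal := Preorder.topology SplitReal

instance : OrderTopology SplitReal := ⟨rfl⟩

namespace SplitReal

/-- The left part `t-` of the real time `t`. -/
def left (t : ℝ) : SplitReal := (toLex (t, false) : ℝ ×ₗ Bool)

/-- The right part `t+` of the real time `t`. -/
def right (t : ℝ) : SplitReal := (toLex (t, true) : ℝ ×ₗ Bool)

/-- The real time `t` underlying `t-` or `t+`. -/
def time (p : SplitReal) : ℝ := (ofLex (p : ℝ ×ₗ Bool)).1

end SplitReal

/-- Càdlàg paths. A path has a closed interval `I = [initialTime, finalTime]` of extended real times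
as its domain, and it is a continuous function with values in `[-∞,∞]` on the set of split real
times `t±` with `t ∈ I ∩ ℝ`. Values at the times `±∞` are not recorded. The function is stored as
a total function on the split real line, with the value `⊥` at all times outside of `I`, so that
two paths are equal if and only if they have the same domain and agree on it. -/
@[ext]
structure CadlagPath where
  initialTime : EReal
  finalTime : EReal
  initialTime_le_finalTime : initialTime ≤ finalTime
  toFun : SplitReal → EReal
  continuousOn_toFun :
    ContinuousOn toFun {p | initialTime ≤ (p.time : EReal) ∧ (p.time : EReal) ≤ finalTime}
  toFun_eq_bot : ∀ p : SplitReal,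
    ¬ (initialTime ≤ (p.time : EReal) ∧ (p.time : EReal) ≤ finalTime) → toFun p = ⊥

/-- The relation on `[-∞,∞] × [-∞,∞]` (first coordinate space, second coordinate time) that
identifies all points with time `-∞`, and all points with time `∞`. -/
def spaceTimeSetoid : Setoid (EReal × EReal) where
  r a b := a.2 = b.2 ∧ (a.2 = ⊥ ∨ a.2 = ⊤ ∨ a.1 = b.1)
  iseqv :=
    { refl := fun _ => ⟨rfl, Or.inr (Or.inr rfl)⟩
      symm := fun {a b} h => by
        obtain ⟨h1, h2⟩ := h
        refine ⟨h1.symm, ?_⟩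
        rw [← h1]
        tauto
      trans := fun {a b c} h k => by
        obtain ⟨h1, h2⟩ := h
        obtain ⟨k1, k2⟩ := k
        refine ⟨h1.trans k1, ?_⟩
        rw [← h1] at k2
        rcases h2 with h2 | h2 | h2
        · exact Or.inl h2
        · exact Or.inr (Or.inl h2)
        · rw [h2]
          exact k2 }

/-- Compactified space-time `([-∞,∞] × ℝ) ∪ {(*,-∞), (*,∞)}`. Its topology is the quotient topology,
so that it is compact and metrizable, it induces the product topology on `[-∞,∞] × ℝ`, and
`(x_n, t_n)` converges to `(*, ±∞)` if and only if `t_n` converges to `±∞`. -/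
def SpaceTime : Type := Quotient spaceTimeSetoid

instance : TopologicalSpace SpaceTime :=
  inferInstanceAs (TopologicalSpace (Quotient spaceTimeSetoid))

/-- The space-time point `(x, t)`, which is `(*, t)` if `t = ±∞`. -/
def SpaceTime.mk (x t : EReal) : SpaceTime := Quotient.mk spaceTimeSetoid (x, t)

namespace CadlagPath

instance : CoeFun CadlagPath (fun _ => SplitReal → EReal) := ⟨CadlagPath.toFun⟩

/-- The value `f(t-)`. It is meaningful for real `t`; for `t = ±∞` it is a junk value, which has no
influence below since space-time has a single point at each of the times `±∞`. -/
noncomputable def leftValue (f : CadlagPath) (t : EReal) : EReal := f (SplitReal.left t.toReal)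

/-- The value `f(t+)`, with the same convention for `t = ±∞`. -/
noncomputable def rightValue (f : CadlagPath) (t : EReal) : EReal := f (SplitReal.right t.toReal)

/-- The condition that `t ∈ I(f)` and that `x` lies on the segment between `f(t-)` and `f(t+)`. -/
def OnGraph (f : CadlagPath) (x t : EReal) : Prop :=
  t ∈ Icc f.initialTime f.finalTime ∧ x ∈ uIcc (f.leftValue t) (f.rightValue t)

/-- The interpolated graph `H(f)`. -/
def interpolatedGraph (f : CadlagPath) : Set SpaceTime :=
  {z | ∃ x t : EReal, f.OnGraph x t ∧ z = SpaceTime.mk x t}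

/-- The second order interpolated graph: the pairs `((x₁,t₁), (x₂,t₂))` of points of `H(f)` such that
the first precedes the second, i.e. `t₁ < t₂`, or `t₁ = t₂` and `x₁` is (non-strictly) closer to
`f(t₁-)` than `x₂`. -/
def interpolatedGraph₂ (f : CadlagPath) : Set (SpaceTime × SpaceTime) :=
  {w | ∃ x₁ t₁ x₂ t₂ : EReal, f.OnGraph x₁ t₁ ∧ f.OnGraph x₂ t₂ ∧
    (t₁ < t₂ ∨ (t₁ = t₂ ∧ x₁ ∈ uIcc (f.leftValue t₁) x₂)) ∧
    w = (SpaceTime.mk x₁ t₁, SpaceTime.mk x₂ t₂)}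

/-- The M1 topology: `f` is identified with the compact set `interpolatedGraph₂ f`, and compact sets
are compared in the Hausdorff topology. The latter, which is generated by the Hausdorff metric of any
metric for the topology of `SpaceTime × SpaceTime`, is the Vietoris topology. -/
instance : TopologicalSpace CadlagPath :=
  TopologicalSpace.induced interpolatedGraph₂ (TopologicalSpace.vietoris (SpaceTime × SpaceTime))

/-- Half-infinite (forwards in time) paths. -/
def IsHalfInfinite (f : CadlagPath) : Prop := f.finalTime = ⊤

/-- Bi-infinite paths. -/
def IsBiInfinite (f : CadlagPath) : Prop := f.initialTime = ⊥ ∧ f.finalTime = ⊤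

/-- The path `g` extends the path `f`. -/
def IsExtendedBy (f g : CadlagPath) : Prop := f.interpolatedGraph₂ ⊆ g.interpolatedGraph₂

/-- The path `f` lies to the left of the path `g`: they have bi-infinite extensions `f'` and `g'`
with `f' ≤ g'` at all times. -/
def LiesLeftOf (f g : CadlagPath) : Prop :=
  ∃ f' g' : CadlagPath, f'.IsBiInfinite ∧ g'.IsBiInfinite ∧ f.IsExtendedBy f' ∧ g.IsExtendedBy g' ∧
    ∀ p : SplitReal, f' p ≤ g' p

/-- The paths `f` and `g` do not cross. -/
def NonCrossing (f g : CadlagPath) : Prop := f.LiesLeftOf g ∨ g.LiesLeftOf f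

/-- The region `L(f) ⊆ [-∞,∞] × SplitReal` strictly to the left of a half-infinite path `f`. At
`t±` with `t > σ`, and at `σ+`, where `σ` is the initial time of `f`, it consists of the
`x < f(t±)`; at `σ-` it consists of the `x < f(σ-)` if `f(σ+) < f(σ-)`, and is empty otherwise. -/
def leftRegion (f : CadlagPath) : Set (EReal × SplitReal) :=
  {q | q.1 < f q.2 ∧
    (f.initialTime < (q.2.time : EReal) ∨
      (f.initialTime = (q.2.time : EReal) ∧
        (q.2 = SplitReal.right q.2.time ∨
          f (SplitReal.right q.2.time) < f (SplitReal.left q.2.time))))}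

end CadlagPath

/-- Deterministic weaves: compact sets of half-infinite paths that are non-crossing and pervasive
(every point of space-time is on the interpolated graph of some path of the set). -/
structure IsDeterministicWeave (A : Set CadlagPath) : Prop where
  isHalfInfinite : ∀ f ∈ A, f.IsHalfInfinite
  isCompact : IsCompact A
  nonCrossing : ∀ f ∈ A, ∀ g ∈ A, f.NonCrossing g
  pervasive : ∀ z : SpaceTime, ∃ f ∈ A, z ∈ f.interpolatedGraph

/-- The paths of `A` that are maximal in `A` for the relation of extension. -/
def maximalPaths (A : Set CadlagPath) : Set CadlagPath :=
  {g | g ∈ A ∧ ∀ f ∈ A, g.IsExtendedBy f → g = f}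

/-- The bi-infinite paths that do not cross any path of `A`. -/
def flow (A : Set CadlagPath) : Set CadlagPath :=
  {h | h.IsBiInfinite ∧ ∀ f ∈ A, h.NonCrossing f}

/-- The Dedekind cuts of the maximal paths of `A`, ordered by `LiesLeftOf`: the downward closed
subsets without a maximal element. -/
def dedekindCuts (A : Set CadlagPath) : Set (Set CadlagPath) :=
  {X | X ⊆ maximalPaths A ∧
    (∀ f ∈ maximalPaths A, ∀ g ∈ X, f.LiesLeftOf g → f ∈ X) ∧
    ¬ ∃ m ∈ X, ∀ f ∈ X, m.LiesLeftOf f → f = m}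

/-- The set `X_h` of the maximal paths of `A` that lie strictly to the left of `h`. -/
def strictlyLeftPaths (A : Set CadlagPath) (h : CadlagPath) : Set CadlagPath :=
  {f | f ∈ maximalPaths A ∧ f.LiesLeftOf h ∧ ¬ f.IsExtendedBy h ∧ ¬ h.IsExtendedBy f}

/-- The right boundary of the closure of the union of the left regions of the paths in `X`, where
the closure is taken in the product space `[-∞,∞] × SplitReal`. -/
noncomputable def rightBoundary (X : Set CadlagPath) (p : SplitReal) : EReal :=
  sSup {x : EReal | (x, p) ∈ closure (⋃ f ∈ X, f.leftRegion)}

/-! A half-infinite path determines its bi-infinite extensions everywhere except at and before `σ-`,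
where `σ` is its initial time. These extensions fill the region between a lower and an upper
envelope, and `f` lies to the left of `g` exactly when `f.lower ≤ g.upper` (`liesLeftOf_iff`). The
order thus becomes a pointwise inequality; it fails to be transitive only because a path that starts
late puts no constraint on earlier times.

Compactness enters through `exists_jump`: if paths of `A` go from a low to a high level in ever
shorter time intervals around `t`, some path of `A` makes that jump at time `t`, and likewise
downwards. An upward and a downward jump across each other at the same time are a crossing
(`NonCrossing.false_of_opposite_jumps`). Suppose `X` lies to the left of all other maximal paths and
its right boundary oscillates at `t`. Then paths of `X` produce a downward jump, and paths through
points just to the right of `X`, which exist because the weave is pervasive, produce an upward one.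
Hence the boundary is continuous (`continuous_rightBoundary`), and it separates `X` from the other
maximal paths, so it is in the flow.

Conversely, every point just below `h` in the flow lies on a maximal path, which then belongs to
`X_h`; so the boundary of `X_h` is `h`. For part 2, the maximal paths that do not have `f` on their
left form such a set `X`. Its boundary lies on both sides of `f`, so one of the two extends the
other. -/

open Filter (Tendsto)

/-! ### Order and neighbourhoods in the split real line -/

namespace SplitReal

@[simp] theorem time_left (t : ℝ) : (left t).time = t := rfl

@[simp] theorem time_right (t : ℝ) : (right t).time = t := rfl

theorem eq_left_or_eq_right (p : SplitReal) : p = left p.time ∨ p = right p.time := by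
  rcases p with ⟨t, b⟩
  cases b
  · exact Or.inl rfl
  · exact Or.inr rfl

theorem lt_of_time_lt {p q : SplitReal} (h : p.time < q.time) : p < q :=
  (Prod.Lex.lt_iff (x := p) (y := q)).2 (Or.inl h)

theorem time_le_of_le {p q : SplitReal} (h : p ≤ q) : p.time ≤ q.time := by
  by_contra hlt
  exact absurd (lt_of_time_lt (not_le.1 hlt)) (not_lt.2 h)

theorem left_lt_right (t : ℝ) : left t < right t :=
  (Prod.Lex.lt_iff (x := left t) (y := right t)).2 (Or.inr ⟨rfl, by simp [left, right]⟩)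

theorem left_ne_right (t : ℝ) : left t ≠ right t := (left_lt_right t).ne

/-- Nothing lies between `t-` and `t+`. Hence each of them has neighbourhoods on one side only. -/
theorem lt_right_iff {p : SplitReal} {t : ℝ} : p < right t ↔ p ≤ left t := by
  constructor
  · intro h
    rcases (time_le_of_le h.le).lt_or_eq with h1 | h1
    · exact (lt_of_time_lt (q := left t) h1).le
    · rcases eq_left_or_eq_right p with h2 | h2
      · rw [time_right] at h1
        rw [h2, h1]
      · rw [h2, h1] at h
        exact absurd h (lt_irrefl _)
  · intro h
    exact h.trans_lt (left_lt_right t)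

theorem left_lt_iff {p : SplitReal} {t : ℝ} : left t < p ↔ right t ≤ p := by
  rw [← not_le, ← lt_right_iff, not_lt]

theorem right_le_iff {p : SplitReal} {t : ℝ} : right t ≤ p ↔ t < p.time ∨ p = right t := by
  constructor
  · intro h
    rcases (time_le_of_le h).lt_or_eq with h1 | h1
    · exact Or.inl h1
    · rcases eq_left_or_eq_right p with h2 | h2
      · rw [h2, ← h1] at h
        exact absurd h (not_le.2 (left_lt_right _))
      · right
        rw [h2, ← h1, time_right]
  · rintro (h | h)
    · exact (lt_of_time_lt (p := right t) h).le
    · exact h.ge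

theorem nhds_left_mem {t ε : ℝ} (hε : 0 < ε) :
    {p : SplitReal | t - ε < p.time ∧ p ≤ left t} ∈ 𝓝 (left t) := by
  filter_upwards [Ioo_mem_nhds (lt_of_time_lt (p := right (t - ε)) (q := left t) (by simpa using hε))
    (left_lt_right t)] with p hp
  have h2 := lt_right_iff.1 hp.2
  refine ⟨?_, h2⟩
  rcases (right_le_iff.1 hp.1.le) with h | h
  · exact h
  · exact absurd hp.1 (by rw [h]; exact lt_irrefl _)

theorem nhds_right_mem {t ε : ℝ} (hε : 0 < ε) :
    {p : SplitReal | p.time < t + ε ∧ right t ≤ p} ∈ 𝓝 (right t) := by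
  filter_upwards [Ioo_mem_nhds (left_lt_right t)
    (lt_of_time_lt (p := right t) (q := left (t + ε)) (by simpa using hε))] with p hp
  refine ⟨?_, left_lt_iff.1 hp.1⟩
  refine (time_le_of_le hp.2.le).lt_of_ne fun h => ?_
  rcases eq_left_or_eq_right p with h2 | h2
  · rw [h2, h] at hp
    exact lt_irrefl _ hp.2
  · rw [h2, h] at hp
    exact lt_asymm hp.2 (left_lt_right _)

theorem exists_of_mem_nhds_left {t : ℝ} {N : Set SplitReal} (hN : N ∈ 𝓝 (left t)) :
    ∃ ε > 0, ∀ p : SplitReal, t - ε < p.time → p ≤ left t → p ∈ N := by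
  obtain ⟨l, hl, h⟩ := exists_Ioc_subset_of_mem_nhds hN
    ⟨left (t - 1), lt_of_time_lt (by simp)⟩
  have hlt : l.time < t := by
    refine (time_le_of_le hl.le).lt_of_ne fun h1 => ?_
    rw [time_left] at h1
    rcases eq_left_or_eq_right l with h2 | h2
    · rw [h2, h1] at hl
      exact lt_irrefl _ hl
    · rw [h2, h1] at hl
      exact lt_asymm hl (left_lt_right _)
  exact ⟨t - l.time, by linarith, fun p hp1 hp2 => h ⟨lt_of_time_lt (by linarith), hp2⟩⟩

theorem exists_of_mem_nhds_right {t : ℝ} {N : Set SplitReal} (hN : N ∈ 𝓝 (right t)) :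
    ∃ ε > 0, ∀ p : SplitReal, p.time < t + ε → right t ≤ p → p ∈ N := by
  obtain ⟨l, hl, h⟩ := exists_Ico_subset_of_mem_nhds hN
    ⟨left (t + 1), lt_of_time_lt (by simp)⟩
  have hlt : t < l.time := by
    rcases right_le_iff.1 hl.le with h1 | h1
    · exact h1
    · exact absurd hl (by rw [h1]; exact lt_irrefl _)
  exact ⟨l.time - t, by linarith, fun p hp1 hp2 => h ⟨hp2, lt_of_time_lt (by linarith)⟩⟩

/-- A graph point at time `s` is only known to lie between `f(s-)` and `f(s+)`, so control of both
parts of `s` is needed. The strict inequality `s < t` ensures that a path through such a point has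
started before `t-`. -/
theorem exists_lt_of_mem_nhds_left {t ε : ℝ} (hε : 0 < ε) {N : Set SplitReal}
    (hN : N ∈ 𝓝 (left t)) : ∃ s, t - ε < s ∧ s < t ∧ left s ∈ N ∧ right s ∈ N := by
  obtain ⟨δ, hδ, h⟩ := exists_of_mem_nhds_left hN
  have hm : 0 < min δ ε := lt_min hδ hε
  have h1 := min_le_left δ ε
  have h2 := min_le_right δ ε
  refine ⟨t - min δ ε / 2, by linarith, by linarith, h _ ?_ ?_, h _ ?_ ?_⟩
  · simp only [time_left]; linarith
  · exact (lt_of_time_lt (by simp only [time_left]; linarith)).le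
  · simp only [time_right]; linarith
  · exact (lt_of_time_lt (by simp only [time_left, time_right]; linarith)).le

theorem exists_gt_of_mem_nhds_right {t ε : ℝ} (hε : 0 < ε) {N : Set SplitReal}
    (hN : N ∈ 𝓝 (right t)) : ∃ s, t < s ∧ s < t + ε ∧ left s ∈ N ∧ right s ∈ N := by
  obtain ⟨δ, hδ, h⟩ := exists_of_mem_nhds_right hN
  have hm : 0 < min δ ε := lt_min hδ hε
  have h1 := min_le_left δ ε
  have h2 := min_le_right δ ε
  refine ⟨t + min δ ε / 2, by linarith, by linarith, h _ ?_ ?_, h _ ?_ ?_⟩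
  · simp only [time_left]; linarith
  · exact (lt_of_time_lt (by simp only [time_left, time_right]; linarith)).le
  · simp only [time_right]; linarith
  · exact (lt_of_time_lt (by simp only [time_right]; linarith)).le

/-- Every neighbourhood of a split time contains both parts of some real time. -/
theorem exists_left_right_mem {p : SplitReal} {N : Set SplitReal} (hN : N ∈ 𝓝 p) :
    ∃ s, left s ∈ N ∧ right s ∈ N := by
  rcases eq_left_or_eq_right p with h | h <;> rw [h] at hN
  · obtain ⟨s, -, -, hs⟩ := exists_lt_of_mem_nhds_left one_pos hN
    exact ⟨s, hs⟩
  · obtain ⟨s, -, -, hs⟩ := exists_gt_of_mem_nhds_right one_pos hN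
    exact ⟨s, hs⟩

end SplitReal

/-! ### Closed sets in compactified space-time -/

namespace SpaceTime

theorem mk_eq_mk_iff {x t x' t' : EReal} :
    mk x t = mk x' t' ↔ t = t' ∧ (t = ⊥ ∨ t = ⊤ ∨ x = x') := Quotient.eq (r := spaceTimeSetoid)

theorem exists_eq_mk (z : SpaceTime) : ∃ x t, z = mk x t := by
  induction z using Quotient.inductionOn with
  | h a => exact ⟨a.1, a.2, rfl⟩

theorem isClosed_iff {C : Set SpaceTime} :
    IsClosed C ↔ IsClosed {a : EReal × EReal | mk a.1 a.2 ∈ C} :=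
  (isQuotientMap_quotient_mk' (s := spaceTimeSetoid)).isClosed_preimage.symm

/-- The space-time points with position in `C` and time in the real interval `[a, b]`. -/
def box (C : Set EReal) (a b : ℝ) : Set SpaceTime :=
  {z | ∃ x ∈ C, ∃ t ∈ Icc a b, z = mk x (t : ℝ)}

theorem isClosed_box {C : Set EReal} (hC : IsClosed C) (a b : ℝ) : IsClosed (box C a b) := by
  rw [isClosed_iff]
  convert! hC.prod (isClosed_Icc (a := (a : EReal)) (b := (b : EReal))) using 1
  ext ⟨x, t⟩
  constructor
  · rintro ⟨x', hx', t', ht', h⟩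
    obtain ⟨rfl, h⟩ := mk_eq_mk_iff.1 h
    have h : x = x' := by simpa using h
    exact ⟨h ▸ hx', by simpa using ht'.1, by simpa using ht'.2⟩
  · rintro ⟨hx, h1, h2⟩
    simp only at h1 h2
    lift t to ℝ using ⟨ne_top_of_le_ne_top (EReal.coe_ne_top b) h2,
      ne_bot_of_le_ne_bot (EReal.coe_ne_bot a) h1⟩
    exact ⟨x, hx, t, ⟨by simpa using h1, by simpa using h2⟩, rfl⟩

instance : T1Space SpaceTime := by
  refine ⟨fun z => ?_⟩
  obtain ⟨x, t, rfl⟩ := exists_eq_mk z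
  rw [isClosed_iff]
  have : {a : EReal × EReal | mk a.1 a.2 ∈ ({mk x t} : Set SpaceTime)} =
      {a : EReal × EReal | a.2 = t ∧ (a.1 = x ∨ (t = ⊥ ∨ t = ⊤))} := by
    ext ⟨y, s⟩
    simp only [mem_singleton_iff, mk_eq_mk_iff, mem_ofPred_eq]
    constructor
    · rintro ⟨rfl, h⟩
      tauto
    · rintro ⟨rfl, h⟩
      tauto
  rw [this]
  exact (isClosed_eq continuous_snd continuous_const).inter
    ((isClosed_eq continuous_fst continuous_const).union isClosed_const)

end SpaceTime

/-! ### One-sided limits of real times -/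

namespace SplitReal

theorem tendsto_left_nhdsGT (t : ℝ) : Tendsto left (𝓝[>] t) (𝓝 (right t)) := by
  refine Filter.tendsto_def.2 fun N hN => ?_
  obtain ⟨ε, hε, h⟩ := exists_of_mem_nhds_right hN
  filter_upwards [Ioo_mem_nhdsGT (show t < t + ε by linarith)] with s hs
  exact h _ hs.2 (right_le_iff.2 (Or.inl hs.1))

theorem tendsto_right_nhdsGT (t : ℝ) : Tendsto right (𝓝[>] t) (𝓝 (right t)) := by
  refine Filter.tendsto_def.2 fun N hN => ?_
  obtain ⟨ε, hε, h⟩ := exists_of_mem_nhds_right hN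
  filter_upwards [Ioo_mem_nhdsGT (show t < t + ε by linarith)] with s hs
  exact h _ hs.2 (right_le_iff.2 (Or.inl hs.1))

theorem tendsto_left_nhdsLT (t : ℝ) : Tendsto left (𝓝[<] t) (𝓝 (left t)) := by
  refine Filter.tendsto_def.2 fun N hN => ?_
  obtain ⟨ε, hε, h⟩ := exists_of_mem_nhds_left hN
  filter_upwards [Ioo_mem_nhdsLT (show t - ε < t by linarith)] with s hs
  exact h _ hs.1 (lt_of_time_lt (p := left s) (q := left t) hs.2).le

theorem tendsto_right_nhdsLT (t : ℝ) : Tendsto right (𝓝[<] t) (𝓝 (left t)) := by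
  refine Filter.tendsto_def.2 fun N hN => ?_
  obtain ⟨ε, hε, h⟩ := exists_of_mem_nhds_left hN
  filter_upwards [Ioo_mem_nhdsLT (show t - ε < t by linarith)] with s hs
  exact h _ hs.1 (lt_of_time_lt (p := right s) (q := left t) hs.2).le

end SplitReal

open SplitReal

/-! ### Extension of paths -/

namespace CadlagPath

variable {f g h : CadlagPath} {p q : SplitReal} {t : ℝ} {x y b : EReal}

/-- The path `f` has started at the split time `p` if `p ≥ σ+`, where `σ` is its initial time. -/
def IsStarted (f : CadlagPath) (p : SplitReal) : Prop :=
  f.initialTime < (p.time : EReal) ∨ (f.initialTime = (p.time : EReal) ∧ p = right p.time)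

theorem IsStarted.initialTime_le (hp : f.IsStarted p) : f.initialTime ≤ (p.time : EReal) :=
  hp.elim le_of_lt fun h => h.1.le

theorem isStarted_right (ht : f.initialTime ≤ (t : EReal)) : f.IsStarted (right t) :=
  ht.lt_or_eq.imp id fun h => ⟨h, rfl⟩

theorem isStarted_left (ht : f.initialTime < (t : EReal)) : f.IsStarted (left t) := Or.inl ht

theorem IsBiInfinite.isStarted (hf : f.IsBiInfinite) (p : SplitReal) : f.IsStarted p := by
  left
  rw [hf.1]
  exact EReal.bot_lt_coe _

theorem IsStarted.mono (hp : f.IsStarted p) (hpq : p ≤ q) : f.IsStarted q := by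
  have h1 := time_le_of_le hpq
  rcases hp with hp | ⟨hp, hp'⟩
  · exact Or.inl (hp.trans_le (by exact_mod_cast h1))
  · rw [hp'] at hpq
    rcases right_le_iff.1 hpq with h2 | h2
    · left
      rw [hp]
      exact_mod_cast h2
    · rw [h2]
      exact Or.inr ⟨hp, rfl⟩

theorem isOpen_isStarted (f : CadlagPath) : IsOpen {p | f.IsStarted p} := by
  rw [isOpen_iff_mem_nhds]
  rintro p (hp | ⟨hp, hp'⟩)
  · obtain ⟨a, ha, hap⟩ := EReal.lt_iff_exists_real_btwn.1 hp
    have : left a < p := lt_of_time_lt (by exact_mod_cast hap)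
    filter_upwards [Ioi_mem_nhds this] with q hq
    exact (isStarted_left ha).mono (le_of_lt hq)
  · have : left p.time < p := by
      conv_rhs => rw [hp']
      exact left_lt_right _
    filter_upwards [Ioi_mem_nhds this] with q hq
    exact (isStarted_right (f := f) hp.le).mono (left_lt_iff.1 hq)

theorem IsHalfInfinite.continuousAt (hf : f.IsHalfInfinite) (hp : f.IsStarted p) :
    ContinuousAt f p := by
  refine f.continuousOn_toFun.continuousAt ?_
  filter_upwards [f.isOpen_isStarted.mem_nhds hp] with q hq
  exact ⟨hq.initialTime_le, by rw [hf]; exact le_top⟩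

theorem IsBiInfinite.isHalfInfinite (hf : f.IsBiInfinite) : f.IsHalfInfinite := hf.2

theorem IsBiInfinite.continuous (hf : f.IsBiInfinite) : Continuous f :=
  continuous_iff_continuousAt.2 fun p => hf.isHalfInfinite.continuousAt (hf.isStarted p)

theorem IsHalfInfinite.onGraph_coe_iff (hf : f.IsHalfInfinite) :
    f.OnGraph x (t : EReal) ↔ f.initialTime ≤ t ∧ x ∈ uIcc (f (left t)) (f (right t)) := by
  unfold OnGraph IsHalfInfinite at *
  rw [hf]
  simp [leftValue, rightValue]

theorem mk_mem_interpolatedGraph₂_iff {t₁ t₂ : ℝ} :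
    (SpaceTime.mk x t₁, SpaceTime.mk y t₂) ∈ f.interpolatedGraph₂ ↔
      f.OnGraph x t₁ ∧ f.OnGraph y t₂ ∧ (t₁ < t₂ ∨ t₁ = t₂ ∧ x ∈ uIcc (f (left t₁)) y) := by
  constructor
  · rintro ⟨x', s₁, y', s₂, h1, h2, h3, h4⟩
    obtain ⟨h5, h6⟩ := Prod.ext_iff.1 h4
    obtain ⟨rfl, h7⟩ := SpaceTime.mk_eq_mk_iff.1 h5
    obtain ⟨rfl, h8⟩ := SpaceTime.mk_eq_mk_iff.1 h6
    obtain rfl : x = x' := by simpa using h7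
    obtain rfl : y = y' := by simpa using h8
    exact ⟨h1, h2, by simpa [leftValue] using h3⟩
  · rintro ⟨h1, h2, h3⟩
    exact ⟨x, t₁, y, t₂, h1, h2, by simpa [leftValue] using h3, rfl⟩

theorem IsExtendedBy.refl (f : CadlagPath) : f.IsExtendedBy f := Subset.refl _

theorem IsExtendedBy.trans (hfg : f.IsExtendedBy g) (hgh : g.IsExtendedBy h) :
    f.IsExtendedBy h := Subset.trans hfg hgh

theorem IsExtendedBy.initialTime_le (hfg : f.IsExtendedBy g) :
    g.initialTime ≤ f.initialTime := by
  have hG : f.OnGraph (f.leftValue f.initialTime) f.initialTime :=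
    ⟨⟨le_rfl, f.initialTime_le_finalTime⟩, left_mem_uIcc⟩
  obtain ⟨x, s, y, s', h1, -, -, h4⟩ := hfg
    ⟨_, _, _, _, hG, hG, Or.inr ⟨rfl, left_mem_uIcc⟩, rfl⟩
  rw [(SpaceTime.mk_eq_mk_iff.1 (Prod.ext_iff.1 h4).1).1]
  exact h1.1.1

theorem IsExtendedBy.values_mem_uIcc (hf : f.IsHalfInfinite) (hg : g.IsHalfInfinite)
    (hfg : f.IsExtendedBy g) (ht : f.initialTime ≤ t) :
    f (left t) ∈ uIcc (g (left t)) (g (right t)) ∧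
      f (right t) ∈ uIcc (g (left t)) (g (right t)) := by
  obtain ⟨h1, h2, -⟩ := mk_mem_interpolatedGraph₂_iff.1 (hfg (mk_mem_interpolatedGraph₂_iff.2
    ⟨hf.onGraph_coe_iff.2 ⟨ht, left_mem_uIcc⟩, hf.onGraph_coe_iff.2 ⟨ht, right_mem_uIcc⟩,
      Or.inr ⟨rfl, left_mem_uIcc⟩⟩))
  exact ⟨(hg.onGraph_coe_iff.1 h1).2, (hg.onGraph_coe_iff.1 h2).2⟩

/-- Inclusion of graphs only puts `f(s±)` between `g(s-)` and `g(s+)`. Letting `s` tend to `t` from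
one side, both bounds converge to the same value of `g`, and a squeeze gives equality. At `σ-` there
are no earlier times of `f` to use, which is why that split time is excluded from `IsStarted`. -/
theorem IsExtendedBy.eq_of_isStarted (hf : f.IsHalfInfinite) (hg : g.IsHalfInfinite)
    (hfg : f.IsExtendedBy g) (hp : f.IsStarted p) : f p = g p := by
  have hgp : g.IsStarted p := by
    rcases hp with hp | hp
    · exact Or.inl (hfg.initialTime_le.trans_lt hp)
    · rw [hp.2]
      exact isStarted_right (hfg.initialTime_le.trans hp.1.le)
  have hfc := hf.continuousAt hp
  have hgc := hg.continuousAt hgp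
  rcases eq_left_or_eq_right p with h | h
  · have hlt : f.initialTime < (p.time : EReal) := by
      rcases hp with hp | hp
      · exact hp
      · exact absurd (h.symm.trans hp.2) (left_ne_right _)
    generalize p.time = t at h hlt
    subst h
    have hev : ∀ᶠ s : ℝ in 𝓝[<] t, f.initialTime ≤ (s : EReal) := by
      obtain ⟨a, ha, hat⟩ := EReal.lt_iff_exists_real_btwn.1 hlt
      filter_upwards [Ioo_mem_nhdsLT (show a < t by exact_mod_cast hat)] with s hs
      exact ha.le.trans (by exact_mod_cast hs.1.le)
    have hl := hgc.tendsto.comp (tendsto_left_nhdsLT t)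
    have hr := hgc.tendsto.comp (tendsto_right_nhdsLT t)
    refine tendsto_nhds_unique (hfc.tendsto.comp (tendsto_left_nhdsLT t))
      (tendsto_of_tendsto_of_tendsto_of_le_of_le' (by simpa using hl.min hr)
        (by simpa using hl.max hr) ?_ ?_)
    · filter_upwards [hev] with s hs
      exact (hfg.values_mem_uIcc hf hg hs).1.1
    · filter_upwards [hev] with s hs
      exact (hfg.values_mem_uIcc hf hg hs).1.2
  · have hle := hp.initialTime_le
    generalize p.time = t at h hle
    subst h
    have hev : ∀ᶠ s : ℝ in 𝓝[>] t, f.initialTime ≤ (s : EReal) := by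
      filter_upwards [self_mem_nhdsWithin] with s hs
      exact hle.trans (by exact_mod_cast (le_of_lt hs))
    have hl := hgc.tendsto.comp (tendsto_left_nhdsGT t)
    have hr := hgc.tendsto.comp (tendsto_right_nhdsGT t)
    refine tendsto_nhds_unique (hfc.tendsto.comp (tendsto_left_nhdsGT t))
      (tendsto_of_tendsto_of_tendsto_of_le_of_le' (by simpa using hl.min hr)
        (by simpa using hl.max hr) ?_ ?_)
    · filter_upwards [hev] with s hs
      exact (hfg.values_mem_uIcc hf hg hs).1.1
    · filter_upwards [hev] with s hs
      exact (hfg.values_mem_uIcc hf hg hs).1.2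

/-- Positions at times `±∞` are immaterial: there they can be replaced by the junk value
`leftValue`, so only real times need checking. -/
theorem IsHalfInfinite.mem_interpolatedGraph₂_of {t₁ t₂ : EReal} (hg : g.IsHalfInfinite)
    (h₁ : g.initialTime ≤ t₁) (h₂ : g.initialTime ≤ t₂)
    (hx : ∀ s : ℝ, t₁ = s → g.OnGraph x s) (hy : ∀ s : ℝ, t₂ = s → g.OnGraph y s)
    (hlt : t₁ < t₂ ∨ t₁ = t₂ ∧ ∀ s : ℝ, t₁ = s → x ∈ uIcc (g (left s)) y) :
    (SpaceTime.mk x t₁, SpaceTime.mk y t₂) ∈ g.interpolatedGraph₂ := by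
  have key : ∀ (z t : EReal), g.initialTime ≤ t → (∀ s : ℝ, t = s → g.OnGraph z s) →
      ∃ z', g.OnGraph z' t ∧ SpaceTime.mk z t = SpaceTime.mk z' t ∧
        (t = ⊥ ∨ t = ⊤ → z' = g.leftValue t) ∧ (∀ s : ℝ, t = s → z' = z) := by
    intro z t ht hz
    induction t with
    | bot => exact ⟨_, ⟨⟨ht, bot_le⟩, left_mem_uIcc⟩, SpaceTime.mk_eq_mk_iff.2 (by simp),
        fun _ => rfl, by simp⟩
    | top => exact ⟨_, ⟨⟨ht, hg.ge⟩, left_mem_uIcc⟩, SpaceTime.mk_eq_mk_iff.2 (by simp),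
        fun _ => rfl, by simp⟩
    | coe s => exact ⟨z, hz s rfl, rfl, by simp, by simp⟩
  obtain ⟨x', hx1, hx2, hx3, hx4⟩ := key x t₁ h₁ hx
  obtain ⟨y', hy1, hy2, hy3, hy4⟩ := key y t₂ h₂ hy
  rw [hx2, hy2]
  refine ⟨x', t₁, y', t₂, hx1, hy1, hlt.imp id ?_, rfl⟩
  rintro ⟨rfl, h⟩
  refine ⟨rfl, ?_⟩
  induction t₁ with
  | bot => rw [hx3 (by simp)]; exact left_mem_uIcc
  | top => rw [hx3 (by simp)]; exact left_mem_uIcc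
  | coe s =>
    rw [hx4 s rfl, hy4 s rfl]
    exact h s rfl

/-- If `f(σ-)` lies anywhere on the jump segment of `g` at time `σ`, then the jump of `f` is the
final piece of the jump of `g`, traversed in the same direction. -/
theorem isExtendedBy_of (hf : f.IsHalfInfinite) (hg : g.IsHalfInfinite)
    (hle : g.initialTime ≤ f.initialTime) (heq : ∀ p, f.IsStarted p → f p = g p)
    (hinit : ∀ t : ℝ, f.initialTime = t → f (left t) ∈ uIcc (g (left t)) (g (right t))) :
    f.IsExtendedBy g := by
  have hl : ∀ s : ℝ, f.initialTime ≤ s → f (left s) ∈ uIcc (g (left s)) (g (right s)) := by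
    intro s hs
    rcases hs.lt_or_eq with h | h
    · rw [heq _ (isStarted_left h)]
      exact left_mem_uIcc
    · exact hinit s h
  have hG : ∀ (z : EReal) (s : ℝ), f.OnGraph z s → g.OnGraph z s := by
    intro z s hz
    rw [hf.onGraph_coe_iff] at hz
    rw [hg.onGraph_coe_iff]
    refine ⟨hle.trans hz.1, uIcc_subset_uIcc (hl s hz.1) ?_ hz.2⟩
    rw [heq _ (isStarted_right hz.1)]
    exact right_mem_uIcc
  rintro w ⟨x, t₁, y, t₂, h1, h2, h3, rfl⟩
  refine hg.mem_interpolatedGraph₂_of (hle.trans h1.1.1) (hle.trans h2.1.1) ?_ ?_ ?_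
  · rintro s rfl
    exact hG x s h1
  · rintro s rfl
    exact hG y s h2
  · refine h3.imp id ?_
    rintro ⟨rfl, h3⟩
    refine ⟨rfl, ?_⟩
    rintro s rfl
    have hy := hf.onGraph_coe_iff.1 h2
    have hls := hl s hy.1
    rw [← heq _ (isStarted_right hy.1)] at hls
    have h3 : x ∈ uIcc (f (left s)) y := by simpa [leftValue] using h3
    have hy := hy.2
    simp only [mem_uIcc] at *
    -- The cases are the orientations of three nested segments that start at `g(s-)` or `f(s-)`.
    -- Inconsistent orientations force some of the points to coincide.
    rcases hls with hls | hls <;> rcases hy with hy | hy <;> rcases h3 with h3 | h3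
    · exact Or.inl ⟨hls.1.trans h3.1, h3.2⟩
    · obtain rfl : y = x := le_antisymm h3.1 (h3.2.trans hy.1)
      exact Or.inl ⟨hls.1.trans hy.1, le_rfl⟩
    · have e := le_antisymm hls.2 (hy.1.trans hy.2)
      have e1 := le_antisymm hy.2 (e ▸ hy.1)
      exact Or.inl ⟨hls.1.trans h3.1, h3.2⟩
    · have e : y = f (left s) := le_antisymm hy.2 (hls.2.trans hy.1)
      have e1 : x = y := le_antisymm (h3.2.trans e.ge) h3.1
      exact Or.inl ⟨hls.1.trans (e ▸ e1.ge), e1.le⟩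
    · have e : y = f (left s) := le_antisymm (hy.2.trans hls.1) hy.1
      have e1 : x = y := le_antisymm h3.2 (e ▸ h3.1)
      exact Or.inr ⟨e1.ge, (e1.le.trans e.le).trans hls.2⟩
    · exact Or.inr ⟨h3.1, h3.2.trans hls.2⟩
    · have e1 : x = y := le_antisymm h3.2 (hy.2.trans h3.1)
      exact Or.inr ⟨e1.ge, (e1.le.trans hy.2).trans hls.2⟩
    · exact Or.inr ⟨h3.1, h3.2.trans hls.2⟩

theorem IsExtendedBy.antisymm (hf : f.IsHalfInfinite) (hg : g.IsHalfInfinite)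
    (hfg : f.IsExtendedBy g) (hgf : g.IsExtendedBy f) : f = g := by
  have hi : f.initialTime = g.initialTime := le_antisymm hgf.initialTime_le hfg.initialTime_le
  refine CadlagPath.ext hi (hf.trans (Eq.symm hg)) (funext fun p => ?_)
  by_cases hp : f.initialTime ≤ (p.time : EReal)
  · by_cases hs : f.IsStarted p
    · exact hfg.eq_of_isStarted hf hg hs
    · have hpl : p = left p.time := by
        rcases eq_left_or_eq_right p with h | h
        · exact h
        · rw [h] at hs
          exact absurd (isStarted_right hp) hs
      have h1 := (hfg.values_mem_uIcc hf hg hp).1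
      have h2 := (hgf.values_mem_uIcc hg hf (hi ▸ hp)).1
      have h3 := hfg.eq_of_isStarted hf hg (isStarted_right hp)
      rw [← h3] at h1
      change f p = g p
      rw [hpl]
      rw [mem_uIcc] at h1 h2
      rcases h1 with h1 | h1 <;> rcases h2 with h2 | h2
      · exact le_antisymm h2.1 h1.1
      · exact le_antisymm (h1.2.trans h2.1) h1.1
      · exact le_antisymm (h2.1) (h2.2.trans h1.1)
      · exact le_antisymm h1.2 h2.2
  · rw [f.toFun_eq_bot p (fun h => hp h.1), g.toFun_eq_bot p (fun h => hp (hi ▸ h.1))]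

theorem IsBiInfinite.eq_of_isExtendedBy (hf : f.IsBiInfinite) (hg : g.IsHalfInfinite)
    (hfg : f.IsExtendedBy g) : f = g := by
  have hgi : g.initialTime = ⊥ := le_bot_iff.1 (hf.1 ▸ hfg.initialTime_le)
  exact CadlagPath.ext (hf.1.trans hgi.symm) (hf.2.trans (Eq.symm hg))
    (funext fun p => hfg.eq_of_isStarted hf.2 hg (hf.isStarted p))

end CadlagPath

/-! ### Envelopes and the left-right order -/

namespace CadlagPath

variable {f g h : CadlagPath} {p q : SplitReal} {t : ℝ} {x y b : EReal}

open Classical in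
/-- The lower envelope of the bi-infinite extensions of `f`; its strict hypograph is the
left region of `f`. -/
noncomputable def lower (f : CadlagPath) (p : SplitReal) : EReal :=
  if f.IsStarted p ∨ (f.initialTime = (p.time : EReal) ∧ f (right p.time) < f (left p.time))
  then f p else ⊥

open Classical in
/-- The upper envelope of the bi-infinite extensions of `f`. -/
noncomputable def upper (f : CadlagPath) (p : SplitReal) : EReal :=
  if f.IsStarted p ∨ (f.initialTime = (p.time : EReal) ∧ f (left p.time) < f (right p.time))
  then f p else ⊤

theorem IsStarted.lower_eq (hp : f.IsStarted p) : f.lower p = f p := if_pos (Or.inl hp)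

theorem IsStarted.upper_eq (hp : f.IsStarted p) : f.upper p = f p := if_pos (Or.inl hp)

theorem lower_le (f : CadlagPath) (p : SplitReal) : f.lower p ≤ f p := by
  unfold lower
  split_ifs
  · exact le_rfl
  · exact bot_le

theorem le_upper (f : CadlagPath) (p : SplitReal) : f p ≤ f.upper p := by
  unfold upper
  split_ifs
  · exact le_rfl
  · exact le_top

theorem lower_left (ht : f.initialTime ≤ (t : EReal)) (hj : f (right t) < f (left t)) :
    f.lower (left t) = f (left t) :=
  if_pos (ht.lt_or_eq.imp isStarted_left fun h => ⟨h, hj⟩)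

theorem upper_left (ht : f.initialTime ≤ (t : EReal)) (hj : f (left t) < f (right t)) :
    f.upper (left t) = f (left t) :=
  if_pos (ht.lt_or_eq.imp isStarted_left fun h => ⟨h, hj⟩)

theorem lower_right (ht : f.initialTime ≤ (t : EReal)) : f.lower (right t) = f (right t) :=
  (isStarted_right ht).lower_eq

theorem upper_right (ht : f.initialTime ≤ (t : EReal)) : f.upper (right t) = f (right t) :=
  (isStarted_right ht).upper_eq

theorem isStarted_or_of_lt_lower (hb : b < f.lower p) : f.IsStarted p ∨
    (f.initialTime = (p.time : EReal) ∧ p = left p.time ∧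
      f (right p.time) < f (left p.time)) := by
  unfold lower at hb
  split_ifs at hb with hc
  · by_cases hs : f.IsStarted p
    · exact Or.inl hs
    · rcases hc with hc | hc
      · exact Or.inl hc
      · refine Or.inr ⟨hc.1, ?_, hc.2⟩
        rcases eq_left_or_eq_right p with h | h
        · exact h
        · exact absurd (Or.inr ⟨hc.1, h⟩) hs
  · exact absurd hb not_lt_bot

theorem isStarted_or_of_upper_lt (hb : f.upper p < b) : f.IsStarted p ∨
    (f.initialTime = (p.time : EReal) ∧ p = left p.time ∧
      f (left p.time) < f (right p.time)) := by
  unfold upper at hb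
  split_ifs at hb with hc
  · by_cases hs : f.IsStarted p
    · exact Or.inl hs
    · rcases hc with hc | hc
      · exact Or.inl hc
      · refine Or.inr ⟨hc.1, ?_, hc.2⟩
        rcases eq_left_or_eq_right p with h | h
        · exact h
        · exact absurd (Or.inr ⟨hc.1, h⟩) hs
  · exact absurd hb not_top_lt

theorem initialTime_le_of_lt_lower (hb : b < f.lower p) : f.initialTime ≤ (p.time : EReal) :=
  (isStarted_or_of_lt_lower hb).elim IsStarted.initialTime_le fun h => h.1.le

/-- The lower envelope is lower semicontinuous except at `σ-` when `f` starts with a downward jump.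
This exceptional case recurs below and is always settled by a jump argument; the upper envelope has
the mirror-image exception. -/
theorem IsHalfInfinite.eventually_lt_lower (hf : f.IsHalfInfinite) (hb : b < f.lower p) :
    (∀ᶠ q in 𝓝 p, b < f.lower q) ∨
      ∃ t : ℝ, f.initialTime = t ∧ p = left t ∧ f (right t) < f (left t) := by
  refine (isStarted_or_of_lt_lower hb).imp (fun hp => ?_) fun h => ⟨_, h⟩
  rw [hp.lower_eq] at hb
  filter_upwards [f.isOpen_isStarted.mem_nhds hp, (hf.continuousAt hp).eventually_const_lt hb]
    with q hq hbq
  rwa [IsStarted.lower_eq hq]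

theorem IsHalfInfinite.eventually_upper_lt (hf : f.IsHalfInfinite) (hb : f.upper p < b) :
    (∀ᶠ q in 𝓝 p, f.upper q < b) ∨
      ∃ t : ℝ, f.initialTime = t ∧ p = left t ∧ f (left t) < f (right t) := by
  refine (isStarted_or_of_upper_lt hb).imp (fun hp => ?_) fun h => ⟨_, h⟩
  rw [hp.upper_eq] at hb
  filter_upwards [f.isOpen_isStarted.mem_nhds hp, (hf.continuousAt hp).eventually_lt_const hb]
    with q hq hbq
  rwa [IsStarted.upper_eq hq]

theorem mem_leftRegion_iff : (x, p) ∈ f.leftRegion ↔ x < f.lower p := by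
  have key : (f.initialTime < (p.time : EReal) ∨ (f.initialTime = (p.time : EReal) ∧
      (p = right p.time ∨ f (right p.time) < f (left p.time)))) ↔
      (f.IsStarted p ∨ (f.initialTime = (p.time : EReal) ∧
        f (right p.time) < f (left p.time))) := by
    unfold IsStarted
    tauto
  change x < f p ∧ _ ↔ _
  rw [key]
  unfold lower
  split_ifs with hc
  · exact and_iff_left hc
  · simp [hc]

theorem IsBiInfinite.lower_eq (hf : f.IsBiInfinite) : f.lower = f.toFun :=
  funext fun p => (hf.isStarted p).lower_eq

theorem IsBiInfinite.upper_eq (hf : f.IsBiInfinite) : f.upper = f.toFun :=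
  funext fun p => (hf.isStarted p).upper_eq

/-- At `σ-` an extension `g` has `f(σ-)` between `g(σ-)` and `f(σ+)`, so a downward initial jump of
`f` forces `f(σ-) ≤ g(σ-)`. -/
theorem IsExtendedBy.lower_le (hf : f.IsHalfInfinite) (hg : g.IsBiInfinite)
    (hfg : f.IsExtendedBy g) (p : SplitReal) : f.lower p ≤ g p := by
  by_contra hlt
  rw [not_le] at hlt
  rcases isStarted_or_of_lt_lower hlt with hp | ⟨hi, hp, hj⟩
  · rw [hp.lower_eq, hfg.eq_of_isStarted hf hg.2 hp] at hlt
    exact lt_irrefl _ hlt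
  · generalize p.time = t at hi hp hj
    subst hp
    have h1 := (hfg.values_mem_uIcc hf hg.2 hi.le).1
    have h2 := hfg.eq_of_isStarted hf hg.2 (isStarted_right hi.le)
    rw [lower_left hi.le hj] at hlt
    rw [← h2, mem_uIcc] at h1
    rcases h1 with h1 | h1
    · exact absurd hj (not_lt.2 h1.2)
    · exact absurd hlt (not_lt.2 h1.2)

theorem IsExtendedBy.le_upper (hf : f.IsHalfInfinite) (hg : g.IsBiInfinite)
    (hfg : f.IsExtendedBy g) (p : SplitReal) : g p ≤ f.upper p := by
  by_contra hlt
  rw [not_le] at hlt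
  rcases isStarted_or_of_upper_lt hlt with hp | ⟨hi, hp, hj⟩
  · rw [hp.upper_eq, hfg.eq_of_isStarted hf hg.2 hp] at hlt
    exact lt_irrefl _ hlt
  · generalize p.time = t at hi hp hj
    subst hp
    have h1 := (hfg.values_mem_uIcc hf hg.2 hi.le).1
    have h2 := hfg.eq_of_isStarted hf hg.2 (isStarted_right hi.le)
    rw [upper_left hi.le hj] at hlt
    rw [← h2, mem_uIcc] at h1
    rcases h1 with h1 | h1
    · exact absurd hlt (not_lt.2 h1.1)
    · exact absurd hj (not_lt.2 h1.1)

/-- The path that is constantly equal to `c`. -/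
noncomputable def const (c : EReal) : CadlagPath where
  initialTime := ⊥
  finalTime := ⊤
  initialTime_le_finalTime := bot_le
  toFun _ := c
  continuousOn_toFun := continuousOn_const
  toFun_eq_bot _ hp := absurd ⟨bot_le, le_top⟩ hp

theorem const_isBiInfinite (c : EReal) : (const c).IsBiInfinite := ⟨rfl, rfl⟩

/-- The started times form a clopen set, so two paths can be glued at `σ` without any matching of
their values. -/
theorem isClosed_isStarted (f : CadlagPath) : IsClosed {p | f.IsStarted p} := by
  rw [← isOpen_compl_iff, isOpen_iff_mem_nhds]
  intro p hp
  have hle : (p.time : EReal) ≤ f.initialTime := not_lt.1 fun h => hp (Or.inl h)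
  rcases hle.lt_or_eq with hlt | heq
  · obtain ⟨a, hpa, ha⟩ := EReal.lt_iff_exists_real_btwn.1 hlt
    have : p < left a := lt_of_time_lt (q := left a) (by exact_mod_cast hpa)
    filter_upwards [Iio_mem_nhds this] with q hq hs
    have h1 : (q.time : EReal) ≤ a := by exact_mod_cast time_le_of_le (le_of_lt hq)
    exact absurd (hs.initialTime_le.trans h1) (not_le.2 ha)
  · have hpl : p = left p.time := by
      rcases eq_left_or_eq_right p with h | h
      · exact h
      · exact absurd (Or.inr ⟨heq.symm, h⟩) hp
    have : p < right p.time := by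
      conv_lhs => rw [hpl]
      exact left_lt_right _
    filter_upwards [Iio_mem_nhds this] with q hq hs
    rw [mem_Iio, lt_right_iff, ← hpl] at hq
    exact hp (hs.mono hq)

open Classical in
/-- The bi-infinite path that follows `k` until `f` starts, and `f` from then on. -/
noncomputable def precede (f k : CadlagPath) (hf : f.IsHalfInfinite) (hk : k.IsBiInfinite) :
    CadlagPath where
  initialTime := ⊥
  finalTime := ⊤
  initialTime_le_finalTime := bot_le
  toFun p := if f.IsStarted p then f p else k p
  continuousOn_toFun := by
    refine Continuous.continuousOn (continuous_iff_continuousAt.2 fun p => ?_)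
    by_cases hp : f.IsStarted p
    · refine (hf.continuousAt hp).congr ?_
      filter_upwards [f.isOpen_isStarted.mem_nhds hp] with q hq
      exact (if_pos hq).symm
    · refine hk.continuous.continuousAt.congr ?_
      filter_upwards [f.isClosed_isStarted.isOpen_compl.mem_nhds hp] with q hq
      exact (if_neg hq).symm
  toFun_eq_bot _ hp := absurd ⟨bot_le, le_top⟩ hp

section precede

variable {k : CadlagPath} {hf : f.IsHalfInfinite} {hk : k.IsBiInfinite}

theorem precede_isBiInfinite : (f.precede k hf hk).IsBiInfinite := ⟨rfl, rfl⟩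

theorem IsStarted.precede_eq (hp : f.IsStarted p) : f.precede k hf hk p = f p := if_pos hp

theorem precede_eq_of_not_isStarted (hp : ¬ f.IsStarted p) : f.precede k hf hk p = k p :=
  if_neg hp

theorem not_isStarted_left (ht : f.initialTime = (t : EReal)) : ¬ f.IsStarted (left t) := by
  rintro (h | h)
  · exact h.ne ht
  · exact left_ne_right _ h.2

theorem isExtendedBy_precede
    (h : ∀ t : ℝ, f.initialTime = t → f (left t) ∈ uIcc (k (left t)) (f (right t))) :
    f.IsExtendedBy (f.precede k hf hk) := by
  refine isExtendedBy_of hf rfl bot_le (fun p hp => hp.precede_eq.symm) fun t ht => ?_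
  rw [precede_eq_of_not_isStarted (not_isStarted_left ht),
    (isStarted_right ht.le).precede_eq]
  exact h t ht

end precede

theorem eq_left_of_not_isStarted (hi : f.initialTime ≤ (p.time : EReal)) (hp : ¬ f.IsStarted p) :
    f.initialTime = p.time ∧ p = left p.time := by
  have hi : f.initialTime = p.time := hi.lt_or_eq.resolve_left fun h => hp (Or.inl h)
  refine ⟨hi, (eq_left_or_eq_right p).resolve_right fun h => hp (Or.inr ⟨hi, h⟩)⟩

/-- A half-infinite path lies to the left of another one if and only if its lower envelope lies below
the upper envelope of the other one. -/
theorem IsHalfInfinite.liesLeftOf_iff (hf : f.IsHalfInfinite) (hg : g.IsHalfInfinite) :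
    f.LiesLeftOf g ↔ ∀ p, f.lower p ≤ g.upper p := by
  constructor
  · rintro ⟨f', g', hf', hg', hff, hgg, hle⟩ p
    exact (hff.lower_le hf hf' p).trans ((hle p).trans (hgg.le_upper hg hg' p))
  · intro hle
    -- The path that starts first is prolonged backwards by the constant value of its own envelope
    -- at its starting time. The other path then follows this prolongation if its initial jump
    -- requires it, and otherwise sits at `⊥` or `⊤`. The junk value of `toReal` at an infinite
    -- initial time is harmless, since the matching condition concerns real initial times only.
    rcases le_total g.initialTime f.initialTime with hi | hi
    · let c : EReal := g.upper (left g.initialTime.toReal)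
      let g' := g.precede (const c) hg (const_isBiInfinite c)
      have hg' : g'.IsBiInfinite := precede_isBiInfinite
      have hgg : g.IsExtendedBy g' := by
        refine isExtendedBy_precede fun t ht => ?_
        have hc : (const c) (left t) = g.upper (left t) := by
          change c = _
          simp only [c, ht, EReal.toReal_coe]
        rw [hc, mem_uIcc]
        by_cases hj : g (left t) < g (right t)
        · rw [upper_left ht.le hj]
          exact Or.inl ⟨le_rfl, hj.le⟩
        · exact Or.inr ⟨not_lt.1 hj, le_upper _ _⟩
      have hfg' : ∀ p, f.lower p ≤ g' p := by
        intro p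
        by_cases hp : g.IsStarted p
        · rw [hp.precede_eq, ← hp.upper_eq]
          exact hle p
        · by_contra hlt
          rw [not_le] at hlt
          have h1 := hi.trans (initialTime_le_of_lt_lower hlt)
          obtain ⟨h2, h3⟩ := eq_left_of_not_isStarted h1 hp
          have hc : g' p = g.upper p := by
            rw [precede_eq_of_not_isStarted hp]
            change c = _
            rw [h3]
            simp only [c, h2, EReal.toReal_coe]
          rw [hc] at hlt
          exact absurd hlt (not_lt.2 (hle p))
      by_cases hj : f (right f.initialTime.toReal) < f (left f.initialTime.toReal)
      · refine ⟨f.precede g' hf hg', g', precede_isBiInfinite, hg',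
          isExtendedBy_precede fun t ht => ?_, hgg, fun p => ?_⟩
        · rw [ht, EReal.toReal_coe] at hj
          rw [mem_uIcc, ← lower_left ht.le hj]
          exact Or.inr ⟨(lower_left ht.le hj).symm ▸ hj.le, hfg' _⟩
        · by_cases hp : f.IsStarted p
          · rw [hp.precede_eq, ← hp.lower_eq]
            exact hfg' p
          · rw [precede_eq_of_not_isStarted hp]
      · refine ⟨f.precede (const ⊥) hf (const_isBiInfinite ⊥), g', precede_isBiInfinite, hg',
          isExtendedBy_precede fun t ht => ?_, hgg, fun p => ?_⟩
        · rw [ht, EReal.toReal_coe, not_lt] at hj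
          exact mem_uIcc.2 (Or.inl ⟨bot_le, hj⟩)
        · by_cases hp : f.IsStarted p
          · rw [hp.precede_eq, ← hp.lower_eq]
            exact hfg' p
          · rw [precede_eq_of_not_isStarted hp]
            exact bot_le
    · let c : EReal := f.lower (left f.initialTime.toReal)
      let f' := f.precede (const c) hf (const_isBiInfinite c)
      have hf' : f'.IsBiInfinite := precede_isBiInfinite
      have hff : f.IsExtendedBy f' := by
        refine isExtendedBy_precede fun t ht => ?_
        have hc : (const c) (left t) = f.lower (left t) := by
          change c = _
          simp only [c, ht, EReal.toReal_coe]
        rw [hc, mem_uIcc]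
        by_cases hj : f (right t) < f (left t)
        · rw [lower_left ht.le hj]
          exact Or.inr ⟨hj.le, le_rfl⟩
        · exact Or.inl ⟨lower_le _ _, not_lt.1 hj⟩
      have hfg' : ∀ p, f' p ≤ g.upper p := by
        intro p
        by_cases hp : f.IsStarted p
        · rw [hp.precede_eq, ← hp.lower_eq]
          exact hle p
        · by_contra hlt
          rw [not_le] at hlt
          have h1 : f.initialTime ≤ p.time := hi.trans
            ((isStarted_or_of_upper_lt hlt).elim IsStarted.initialTime_le fun h => h.1.le)
          obtain ⟨h2, h3⟩ := eq_left_of_not_isStarted h1 hp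
          have hc : f' p = f.lower p := by
            rw [precede_eq_of_not_isStarted hp]
            change c = _
            rw [h3]
            simp only [c, h2, EReal.toReal_coe]
          rw [hc] at hlt
          exact absurd hlt (not_lt.2 (hle p))
      by_cases hj : g (left g.initialTime.toReal) < g (right g.initialTime.toReal)
      · refine ⟨f', g.precede f' hg hf', hf', precede_isBiInfinite, hff,
          isExtendedBy_precede fun t ht => ?_, fun p => ?_⟩
        · rw [ht, EReal.toReal_coe] at hj
          rw [mem_uIcc, ← upper_left ht.le hj]
          exact Or.inl ⟨hfg' _, (upper_left ht.le hj).symm ▸ hj.le⟩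
        · by_cases hp : g.IsStarted p
          · rw [hp.precede_eq, ← hp.upper_eq]
            exact hfg' p
          · rw [precede_eq_of_not_isStarted hp]
      · refine ⟨f', g.precede (const ⊤) hg (const_isBiInfinite ⊤), hf', precede_isBiInfinite, hff,
          isExtendedBy_precede fun t ht => ?_, fun p => ?_⟩
        · rw [ht, EReal.toReal_coe, not_lt] at hj
          exact mem_uIcc.2 (Or.inr ⟨hj, le_top⟩)
        · by_cases hp : g.IsStarted p
          · rw [hp.precede_eq, ← hp.upper_eq]
            exact hfg' p
          · rw [precede_eq_of_not_isStarted hp]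
            exact le_top

theorem LiesLeftOf.of_isExtendedBy_left (hfg : f.IsExtendedBy g) (hgh : g.LiesLeftOf h) :
    f.LiesLeftOf h := by
  obtain ⟨g', h', hg, hh, h1, h2, h3⟩ := hgh
  exact ⟨g', h', hg, hh, hfg.trans h1, h2, h3⟩

theorem LiesLeftOf.of_isExtendedBy_right (hhg : h.IsExtendedBy g) (hfg : f.LiesLeftOf g) :
    f.LiesLeftOf h := by
  obtain ⟨f', g', hf, hg, h1, h2, h3⟩ := hfg
  exact ⟨f', g', hf, hg, h1, hhg.trans h2, h3⟩

theorem LiesLeftOf.refl (hf : f.IsHalfInfinite) : f.LiesLeftOf f :=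
  (hf.liesLeftOf_iff hf).2 fun p => (lower_le f p).trans (le_upper f p)

theorem IsExtendedBy.liesLeftOf (hg : g.IsHalfInfinite) (hfg : f.IsExtendedBy g) :
    f.LiesLeftOf g := (LiesLeftOf.refl hg).of_isExtendedBy_left hfg

theorem IsExtendedBy.liesLeftOf' (hg : g.IsHalfInfinite) (hfg : f.IsExtendedBy g) :
    g.LiesLeftOf f := (LiesLeftOf.refl hg).of_isExtendedBy_right hfg

/-- Both envelopes of a bi-infinite middle path equal the path itself, so the two inequalities can
be chained. -/
theorem LiesLeftOf.trans_isBiInfinite (hf : f.IsHalfInfinite) (hg : g.IsBiInfinite)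
    (hh : h.IsHalfInfinite) (hfg : f.LiesLeftOf g) (hgh : g.LiesLeftOf h) : f.LiesLeftOf h := by
  rw [hf.liesLeftOf_iff hg.2, hg.upper_eq] at hfg
  rw [hg.isHalfInfinite.liesLeftOf_iff hh, hg.lower_eq] at hgh
  exact (hf.liesLeftOf_iff hh).2 fun p => (hfg p).trans (hgh p)

theorem IsStarted.of_initialTime_le (hg : f.initialTime ≤ g.initialTime)
    (hp : g.IsStarted p) : f.IsStarted p := by
  rcases hp with hp | hp
  · exact Or.inl (hg.trans_lt hp)
  · rw [hp.2]
    exact isStarted_right (hg.trans hp.1.le)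

theorem isExtendedBy_of_liesLeftOf_of_initialTime_lt (hf : f.IsHalfInfinite)
    (hg : g.IsHalfInfinite) (hfg : f.LiesLeftOf g) (hgf : g.LiesLeftOf f)
    (hi : g.initialTime < f.initialTime) : f.IsExtendedBy g := by
  rw [hf.liesLeftOf_iff hg] at hfg
  rw [hg.liesLeftOf_iff hf] at hgf
  have heq : ∀ p, f.IsStarted p → f p = g p := by
    intro p hp
    have hgp : g.IsStarted p := hp.of_initialTime_le hi.le
    have h1 := hfg p
    have h2 := hgf p
    rw [hp.lower_eq, hgp.upper_eq] at h1
    rw [hp.upper_eq, hgp.lower_eq] at h2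
    exact le_antisymm h1 h2
  refine isExtendedBy_of hf hg hi.le heq fun t ht => ?_
  rw [← heq _ (isStarted_right ht.le), mem_uIcc]
  have hgp : g.IsStarted (left t) := isStarted_left (ht ▸ hi)
  have h1 := hfg (left t)
  have h2 := hgf (left t)
  rw [hgp.upper_eq] at h1
  rw [hgp.lower_eq] at h2
  rcases lt_trichotomy (f (left t)) (f (right t)) with hj | hj | hj
  · rw [upper_left ht.le hj] at h2
    exact Or.inl ⟨h2, hj.le⟩
  · rw [hj]
    exact (le_total (g (left t)) (f (right t))).imp (fun h => ⟨h, le_rfl⟩) (fun h => ⟨le_rfl, h⟩)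
  · rw [lower_left ht.le hj] at h1
    exact Or.inr ⟨hj.le, h1⟩

/-- The two paths agree once both have started. If they start at the same real time, the envelope
inequalities forbid initial jumps in opposite directions, so the two values at `σ-` lie on the same
side of the common value at `σ+`, and the nearer one belongs to the extended path. -/
theorem LiesLeftOf.isExtendedBy_or (hf : f.IsHalfInfinite) (hg : g.IsHalfInfinite)
    (hfg : f.LiesLeftOf g) (hgf : g.LiesLeftOf f) : f.IsExtendedBy g ∨ g.IsExtendedBy f := by
  rcases lt_trichotomy g.initialTime f.initialTime with hi | hi | hi
  · exact Or.inl (isExtendedBy_of_liesLeftOf_of_initialTime_lt hf hg hfg hgf hi)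
  · rw [hf.liesLeftOf_iff hg] at hfg
    rw [hg.liesLeftOf_iff hf] at hgf
    have heq : ∀ p, f.IsStarted p → f p = g p := by
      intro p hp
      have hgp : g.IsStarted p := hp.of_initialTime_le hi.le
      have h1 := hfg p
      have h2 := hgf p
      rw [hp.lower_eq, hgp.upper_eq] at h1
      rw [hp.upper_eq, hgp.lower_eq] at h2
      exact le_antisymm h1 h2
    have heq' : ∀ p, g.IsStarted p → g p = f p := fun p hp => (heq p (hp.of_initialTime_le hi.ge)).symm
    by_cases ht : ∃ t : ℝ, f.initialTime = t
    · obtain ⟨t, ht⟩ := ht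
      have htg := hi.trans ht
      have hr := heq _ (isStarted_right ht.le)
      have key : f (left t) ∈ uIcc (g (left t)) (g (right t)) ∨
          g (left t) ∈ uIcc (f (left t)) (f (right t)) := by
        have h1 := hfg (left t)
        have h2 := hgf (left t)
        rw [hr]
        simp only [mem_uIcc]
        rcases lt_trichotomy (f (left t)) (f (right t)) with hj | hj | hj
        · rw [upper_left ht.le hj] at h2
          rcases lt_or_ge (g (right t)) (g (left t)) with hk | hk
          · rw [lower_left htg.le hk] at h2
            rw [hr] at hj
            exact absurd (hk.trans_le h2) (lt_asymm hj)
          · rw [hr] at hj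
            rcases le_total (f (left t)) (g (left t)) with hl | hl
            · exact Or.inr (Or.inl ⟨hl, hk⟩)
            · exact Or.inl (Or.inl ⟨hl, hj.le⟩)
        · rw [hj, hr]
          left
          exact (le_total (g (left t)) (g (right t))).imp (fun h => ⟨h, le_rfl⟩)
            (fun h => ⟨le_rfl, h⟩)
        · rw [lower_left ht.le hj] at h1
          rcases lt_or_ge (g (left t)) (g (right t)) with hk | hk
          · rw [upper_left htg.le hk] at h1
            rw [hr] at hj
            exact absurd (h1.trans_lt hk) (lt_asymm hj)
          · rw [hr] at hj
            rcases le_total (f (left t)) (g (left t)) with hl | hl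
            · exact Or.inl (Or.inr ⟨hj.le, hl⟩)
            · exact Or.inr (Or.inr ⟨hk, hl⟩)
      refine key.imp (fun key => ?_) (fun key => ?_)
      · refine isExtendedBy_of hf hg hi.le heq fun s hs => ?_
        obtain rfl : t = s := by exact_mod_cast ht.symm.trans hs
        exact key
      · refine isExtendedBy_of hg hf hi.ge heq' fun s hs => ?_
        obtain rfl : t = s := by exact_mod_cast htg.symm.trans hs
        exact key
    · exact Or.inl (isExtendedBy_of hf hg hi.le heq fun t h => absurd ⟨t, h⟩ ht)
  · exact Or.inr (isExtendedBy_of_liesLeftOf_of_initialTime_lt hg hf hgf hfg hi)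

/-- A cycle of half-infinite paths for the relation `LiesLeftOf`, one pair of which lies in only one
order, contains a path that is extended by one of that pair. -/
theorem LiesLeftOf.isExtendedBy_of_cycle (hf : f.IsHalfInfinite) (hg : g.IsHalfInfinite)
    (hh : h.IsHalfInfinite) (hfg : f.LiesLeftOf g) (hgh : g.LiesLeftOf h) (hhf : h.LiesLeftOf f)
    (hfh : ¬ f.LiesLeftOf h) : g.IsExtendedBy f ∨ g.IsExtendedBy h := by
  rw [hf.liesLeftOf_iff hg] at hfg
  rw [hg.liesLeftOf_iff hh] at hgh
  rw [hh.liesLeftOf_iff hf] at hhf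
  rw [hf.liesLeftOf_iff hh] at hfh
  push Not at hfh
  obtain ⟨p, hp⟩ := hfh
  -- At `p`, where `f` is strictly above `h`, a started `g` would give `f.lower p ≤ g p ≤ h.upper
  -- p`. So `g` starts no earlier than `f` and `h`, and going round the cycle shows that all three
  -- agree from then on.
  have hgp : ¬ g.IsStarted p := by
    intro hgp
    have h1 := hfg p
    have h2 := hgh p
    rw [hgp.upper_eq] at h1
    rw [hgp.lower_eq] at h2
    exact absurd (h1.trans h2) (not_le.2 hp)
  have hfp := isStarted_or_of_lt_lower hp
  have hhp := isStarted_or_of_upper_lt hp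
  have hfi := initialTime_le_of_lt_lower hp
  have hhi : h.initialTime ≤ p.time := hhp.elim IsStarted.initialTime_le fun h => h.1.le
  have hgi : (p.time : EReal) ≤ g.initialTime := not_lt.1 fun h => hgp (Or.inl h)
  have heqf : ∀ q, g.IsStarted q → g q = f q := by
    intro q hq
    have h1 := hfg q
    have h2 := hgh q
    have h3 := hhf q
    have hfq : f.IsStarted q := hq.of_initialTime_le (hfi.trans hgi)
    have hhq : h.IsStarted q := hq.of_initialTime_le (hhi.trans hgi)
    rw [hfq.lower_eq, hq.upper_eq] at h1
    rw [hq.lower_eq, hhq.upper_eq] at h2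
    rw [hhq.lower_eq, hfq.upper_eq] at h3
    exact le_antisymm (h2.trans h3) h1
  have heqh : ∀ q, g.IsStarted q → g q = h q := by
    intro q hq
    have h1 := hfg q
    have h2 := hgh q
    have h3 := hhf q
    have hfq : f.IsStarted q := hq.of_initialTime_le (hfi.trans hgi)
    have hhq : h.IsStarted q := hq.of_initialTime_le (hhi.trans hgi)
    rw [hfq.lower_eq, hq.upper_eq] at h1
    rw [hq.lower_eq, hhq.upper_eq] at h2
    rw [hhq.lower_eq, hfq.upper_eq] at h3
    exact le_antisymm h2 (h3.trans h1)
  by_cases ht : ∃ t : ℝ, g.initialTime = t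
  · obtain ⟨t, ht⟩ := ht
    have hpt : p.time ≤ t := by
      rw [ht] at hgi
      exact_mod_cast hgi
    have hlf : f.lower (left t) = f (left t) := by
      rcases hfp with hfp | ⟨h1, h2, h3⟩
      · refine (hfp.mono ?_).lower_eq
        rw [ht] at hgi
        rcases eq_left_or_eq_right p with h | h
        · rcases hpt.lt_or_eq with h1 | h1
          · exact (lt_of_time_lt (q := left t) h1).le
          · exact (h.trans (by rw [h1])).le
        · rcases hpt.lt_or_eq with h1 | h1
          · exact (lt_of_time_lt (q := left t) h1).le
          · rw [h1] at h
            exact absurd (h ▸ isStarted_right ht.le) hgp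
      · rcases hpt.lt_or_eq with h4 | h4
        · exact (isStarted_left (h1.trans_lt (by exact_mod_cast h4))).lower_eq
        · rw [h4] at h1 h3
          exact lower_left h1.le h3
    have huh : h.upper (left t) = h (left t) := by
      rcases hhp with hhp | ⟨h1, h2, h3⟩
      · refine (hhp.mono ?_).upper_eq
        rcases hpt.lt_or_eq with h1 | h1
        · exact (lt_of_time_lt (q := left t) h1).le
        · rcases eq_left_or_eq_right p with h | h
          · exact (h.trans (by rw [h1])).le
          · rw [h1] at h
            exact absurd (h ▸ isStarted_right ht.le) hgp
      · rcases hpt.lt_or_eq with h4 | h4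
        · exact (isStarted_left (h1.trans_lt (by exact_mod_cast h4))).upper_eq
        · rw [h4] at h1 h3
          exact upper_left h1.le h3
    have h1 := hfg (left t)
    have h2 := hgh (left t)
    rw [hlf] at h1
    rw [huh] at h2
    -- The direction of the initial jump of `g` decides which path extends it: `f` bounds `g(t-)`
    -- from below when the jump is upward, `h` bounds it from above when the jump is downward.
    rcases le_or_gt (g (left t)) (g (right t)) with hj | hj
    · left
      refine isExtendedBy_of hg hf (hfi.trans hgi) heqf fun s hs => ?_
      obtain rfl : t = s := by exact_mod_cast ht.symm.trans hs
      rw [← heqf _ (isStarted_right ht.le), mem_uIcc]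
      rcases hj.lt_or_eq with hj' | hj'
      · rw [upper_left ht.le hj'] at h1
        exact Or.inl ⟨h1, hj⟩
      · exact (le_total (f (left t)) (g (left t))).imp (fun h => ⟨h, hj⟩)
          (fun h => ⟨hj'.ge, h⟩)
    · right
      refine isExtendedBy_of hg hh (hhi.trans hgi) heqh fun s hs => ?_
      obtain rfl : t = s := by exact_mod_cast ht.symm.trans hs
      rw [← heqh _ (isStarted_right ht.le), mem_uIcc]
      rw [lower_left ht.le hj] at h2
      exact Or.inr ⟨hj.le, h2⟩
  · exact Or.inl (isExtendedBy_of hg hf (hfi.trans hgi) heqf fun t h => absurd ⟨t, h⟩ ht)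

/-- Two half-infinite paths that jump across each other in opposite directions do cross. -/
theorem NonCrossing.false_of_opposite_jumps (hf : f.IsHalfInfinite) (hg : g.IsHalfInfinite)
    (hfg : f.NonCrossing g) (hft : f.initialTime ≤ (t : EReal)) (hgt : g.initialTime ≤ (t : EReal))
    (hjf : f (right t) < f (left t)) (hjg : g (left t) < g (right t))
    (hl : g (left t) < f (left t)) (hr : f (right t) < g (right t)) : False := by
  rcases hfg with h | h
  · rw [hf.liesLeftOf_iff hg] at h
    have := h (left t)
    rw [lower_left hft hjf, upper_left hgt hjg] at this
    exact absurd hl (not_lt.2 this)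
  · rw [hg.liesLeftOf_iff hf] at h
    have := h (right t)
    rw [lower_right hgt, upper_right hft] at this
    exact absurd hr (not_lt.2 this)

theorem NonCrossing.symm (hfg : f.NonCrossing g) : g.NonCrossing f := Or.symm hfg

end CadlagPath

/-! ### Compactness: maximal paths and limiting jumps -/

namespace CadlagPath

variable {f g h : CadlagPath} {A : Set CadlagPath} {p q : SplitReal} {t : ℝ} {x y b : EReal}

theorem isClosed_setOf_interpolatedGraph₂_inter_nonempty {K : Set (SpaceTime × SpaceTime)}
    (hK : IsClosed K) : IsClosed {f : CadlagPath | (f.interpolatedGraph₂ ∩ K).Nonempty} := by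
  let _ : TopologicalSpace (Set (SpaceTime × SpaceTime)) := TopologicalSpace.vietoris _
  exact (TopologicalSpace.vietoris.isClosed_inter_nonempty_of_isClosed hK).preimage
    continuous_induced_dom

/-- Extending `f` means meeting each singleton of its second order graph, and points of space-time
are closed. Compactness then bounds chains of extensions. -/
theorem isClosed_setOf_isExtendedBy (f : CadlagPath) : IsClosed {g | f.IsExtendedBy g} := by
  have : {g | f.IsExtendedBy g} = ⋂ w ∈ f.interpolatedGraph₂,
      {g : CadlagPath | (g.interpolatedGraph₂ ∩ {w}).Nonempty} := by
    ext g
    simp only [mem_ofPred_eq, mem_iInter, inter_singleton_nonempty]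
    exact Iff.rfl
  rw [this]
  exact isClosed_biInter fun w _ =>
    isClosed_setOf_interpolatedGraph₂_inter_nonempty isClosed_singleton

/-- Every path of a compact set of half-infinite paths is extended by a maximal one. -/
theorem exists_mem_maximalPaths (hA : ∀ f ∈ A, f.IsHalfInfinite) (hc : IsCompact A) (hf : f ∈ A) :
    ∃ g ∈ maximalPaths A, f.IsExtendedBy g := by
  let r : {g // g ∈ A ∧ f.IsExtendedBy g} → {g // g ∈ A ∧ f.IsExtendedBy g} → Prop :=
    fun a b => a.1.IsExtendedBy b.1
  have hchains : ∀ c, IsChain r c → ∃ ub, ∀ a ∈ c, r a ub := by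
    intro c hchain
    rcases c.eq_empty_or_nonempty with rfl | ⟨a₀, ha₀⟩
    · exact ⟨⟨f, hf, IsExtendedBy.refl f⟩, by simp⟩
    · by_contra hub
      have : Nonempty c := ⟨⟨a₀, ha₀⟩⟩
      obtain ⟨a, ha⟩ := hc.elim_directed_family_closed
        (fun a : c => {g | a.1.1.IsExtendedBy g}) (fun a => isClosed_setOf_isExtendedBy _)
        (by
          rw [eq_empty_iff_forall_notMem]
          rintro g ⟨hg, hg'⟩
          rw [mem_iInter] at hg'
          exact hub ⟨⟨g, hg, a₀.2.2.trans (hg' ⟨a₀, ha₀⟩)⟩, fun a ha => hg' ⟨a, ha⟩⟩)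
        (by
          intro a b
          rcases eq_or_ne a b with rfl | hab
          · exact ⟨a, Subset.rfl, Subset.rfl⟩
          · rcases hchain a.2 b.2 (fun h => hab (Subtype.ext h)) with h | h
            · exact ⟨b, fun g hg => IsExtendedBy.trans h hg, Subset.rfl⟩
            · exact ⟨a, Subset.rfl, fun g hg => IsExtendedBy.trans h hg⟩)
      exact (ha ▸ (⟨a.1.2.1, IsExtendedBy.refl _⟩ :
        a.1.1 ∈ A ∩ {g | a.1.1.IsExtendedBy g}) : a.1.1 ∈ (∅ : Set CadlagPath))
  obtain ⟨m, hm⟩ := exists_maximal_of_chains_bounded hchains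
    (fun {a b c} h1 h2 => IsExtendedBy.trans h1 h2)
  refine ⟨m.1, ⟨m.2.1, fun g hg hmg => ?_⟩, m.2.2⟩
  exact hmg.antisymm (hA _ m.2.1) (hA _ hg) (hm ⟨g, hg, m.2.2.trans hmg⟩ hmg)

/-- A path that visits `C` and later `D` within every neighbourhood of time `t`, makes a jump from `C`
to `D` at time `t`. -/
theorem IsHalfInfinite.mem_of_forall_interpolatedGraph₂ (hf : f.IsHalfInfinite) {C D : Set EReal}
    (hC : IsClosed C) (hD : IsClosed D) (hCD : Disjoint C D) (hC' : OrdConnected Cᶜ)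
    (hD' : OrdConnected Dᶜ)
    (H : ∀ ε > 0, (f.interpolatedGraph₂ ∩ (SpaceTime.box C (t - ε) (t + ε) ×ˢ
      SpaceTime.box D (t - ε) (t + ε))).Nonempty) :
    f.initialTime ≤ t ∧ f (left t) ∈ C ∧ f (right t) ∈ D := by
  have H' : ∀ ε > 0, ∃ (x y : EReal) (s₁ s₂ : ℝ), x ∈ C ∧ y ∈ D ∧ t - ε ≤ s₁ ∧ s₂ ≤ t + ε ∧
      f.initialTime ≤ s₁ ∧ x ∈ uIcc (f (left s₁)) (f (right s₁)) ∧
      y ∈ uIcc (f (left s₂)) (f (right s₂)) ∧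
      (s₁ < s₂ ∨ s₁ = s₂ ∧ x ∈ uIcc (f (left s₁)) y) := by
    intro ε hε
    obtain ⟨w, hw, ⟨x, hx, s₁, hs₁, h1⟩, ⟨y, hy, s₂, hs₂, h2⟩⟩ := H ε hε
    obtain rfl : w = (SpaceTime.mk x s₁, SpaceTime.mk y s₂) := Prod.ext h1 h2
    obtain ⟨h3, h4, h5⟩ := mk_mem_interpolatedGraph₂_iff.1 hw
    rw [hf.onGraph_coe_iff] at h3 h4
    exact ⟨x, y, s₁, s₂, hx, hy, hs₁.1, hs₂.2, h3.1, h3.2, h4.2, h5⟩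
  have hle : ∀ {s₁ s₂ : ℝ} {Q : Prop}, (s₁ < s₂ ∨ s₁ = s₂ ∧ Q) → s₁ ≤ s₂ :=
    fun h => h.elim le_of_lt fun h => h.1.le
  have hi : f.initialTime ≤ t := by
    by_contra hlt
    obtain ⟨a, hta, ha⟩ := EReal.lt_iff_exists_real_btwn.1 (not_le.1 hlt)
    have hta : t < a := by exact_mod_cast hta
    obtain ⟨x, y, s₁, s₂, -, -, -, h1, h2, -, -, h3⟩ := H' (a - t) (by linarith)
    have h4 : s₁ ≤ a := by linarith [hle h3]
    exact absurd (h2.trans (by exact_mod_cast h4)) (not_le.2 ha)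
  -- If `f(t-)` is off `E`, then so are the values shortly before `t`, and the jump segments between
  -- them too because `Eᶜ` is order-convex. Hence nearby visits to `E` happen at time `t` or later;
  -- `key'` is the analogue after `t`.
  have key : ∀ E : Set EReal, IsClosed E → OrdConnected Eᶜ → f (left t) ∉ E →
      ∃ ε > 0, ∀ (s : ℝ) (z : EReal), z ∈ E → t - ε ≤ s → f.initialTime ≤ s →
        z ∈ uIcc (f (left s)) (f (right s)) → t ≤ s := by
    intro E hE hE' hl
    rcases hi.lt_or_eq with hlt | heq
    · have hN := (hf.continuousAt (isStarted_left hlt)).preimage_mem_nhds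
        (hE.isOpen_compl.mem_nhds hl)
      obtain ⟨ε, hε, h⟩ := exists_of_mem_nhds_left hN
      refine ⟨ε / 2, by linarith, fun s z hz h1 _ h2 => ?_⟩
      by_contra hst
      rw [not_le] at hst
      exact hE'.uIcc_subset (h (left s) (by simp only [time_left]; linarith)
        (lt_of_time_lt (p := left s) (q := left t) hst).le)
        (h (right s) (by simp only [time_right]; linarith)
        (lt_of_time_lt (p := right s) (q := left t) hst).le) h2 hz
    · refine ⟨1, one_pos, fun s z _ _ h1 _ => ?_⟩
      rw [heq] at h1
      exact_mod_cast h1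
  have key' : ∀ E : Set EReal, IsClosed E → OrdConnected Eᶜ → f (right t) ∉ E →
      ∃ ε > 0, ∀ (s : ℝ) (z : EReal), z ∈ E → s ≤ t + ε → z ∈ uIcc (f (left s)) (f (right s)) →
        s ≤ t := by
    intro E hE hE' hl
    have hN := (hf.continuousAt (isStarted_right hi)).preimage_mem_nhds
      (hE.isOpen_compl.mem_nhds hl)
    obtain ⟨ε, hε, h⟩ := exists_of_mem_nhds_right hN
    refine ⟨ε / 2, by linarith, fun s z hz h1 h2 => ?_⟩
    by_contra hst
    rw [not_le] at hst
    exact hE'.uIcc_subset (h (left s) (by simp only [time_left]; linarith)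
      (lt_of_time_lt (p := right t) (q := left s) hst).le)
      (h (right s) (by simp only [time_right]; linarith)
      (lt_of_time_lt (p := right t) (q := right s) hst).le) h2 hz
  have hfC : f (left t) ∈ C := by
    by_contra hl
    obtain ⟨ε₁, hε₁, h1⟩ := key C hC hC' hl
    by_cases hr : f (right t) ∈ C
    · obtain ⟨ε₂, hε₂, h2⟩ := key' D hD hD' (hCD.notMem_of_mem_left hr)
      obtain ⟨x, y, s₁, s₂, hx, hy, hs₁, hs₂, hi₁, hxs, hys, hlt⟩ :=
        H' (min ε₁ ε₂) (lt_min hε₁ hε₂)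
      have h3 := h1 s₁ x hx (by linarith [min_le_left ε₁ ε₂]) hi₁ hxs
      have h4 := h2 s₂ y hy (by linarith [min_le_right ε₁ ε₂]) hys
      obtain rfl : s₁ = t := by linarith [hle hlt]
      rcases hlt with hlt | ⟨-, hlt⟩
      · linarith
      -- Both visits take place inside the jump at time `t`. The order recorded by the second order
      -- graph puts `x` between `f(t-)` and `y`, neither of which is in `C`.
      · exact hC'.uIcc_subset hl (hCD.notMem_of_mem_right hy) hlt hx
    · obtain ⟨ε₂, hε₂, h2⟩ := key' C hC hC' hr
      obtain ⟨x, y, s₁, s₂, hx, hy, hs₁, hs₂, hi₁, hxs, hys, hlt⟩ :=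
        H' (min ε₁ ε₂) (lt_min hε₁ hε₂)
      have h3 := h1 s₁ x hx (by linarith [min_le_left ε₁ ε₂]) hi₁ hxs
      have h4 := h2 s₁ x hx (by linarith [min_le_right ε₁ ε₂, hle hlt]) hxs
      obtain rfl : s₁ = t := le_antisymm h4 h3
      exact hC'.uIcc_subset hl hr hxs hx
  refine ⟨hi, hfC, ?_⟩
  by_contra hr
  have hl := hCD.notMem_of_mem_left hfC
  obtain ⟨ε₁, hε₁, h1⟩ := key D hD hD' hl
  obtain ⟨ε₂, hε₂, h2⟩ := key' D hD hD' hr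
  obtain ⟨x, y, s₁, s₂, hx, hy, hs₁, hs₂, hi₁, hxs, hys, hlt⟩ :=
    H' (min ε₁ ε₂) (lt_min hε₁ hε₂)
  have hi₂ : f.initialTime ≤ s₂ := hi₁.trans (by exact_mod_cast hle hlt)
  have h3 := h1 s₂ y hy (by linarith [min_le_left ε₁ ε₂, hle hlt]) hi₂ hys
  have h4 := h2 s₂ y hy (by linarith [min_le_right ε₁ ε₂]) hys
  obtain rfl : s₂ = t := le_antisymm h4 h3
  exact hD'.uIcc_subset hl hr hys hy

/-- If there are paths in a compact set that go from `C` to `D` within arbitrarily short time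
intervals around `t`, then some path in the set jumps from `C` to `D` at time `t`. -/
theorem exists_jump (hA : ∀ f ∈ A, f.IsHalfInfinite) (hc : IsCompact A) {C D : Set EReal}
    (hC : IsClosed C) (hD : IsClosed D) (hCD : Disjoint C D) (hC' : OrdConnected Cᶜ)
    (hD' : OrdConnected Dᶜ)
    (H : ∀ ε > 0, ∃ f ∈ A, ∃ (x y : EReal) (s₁ s₂ : ℝ), x ∈ C ∧ y ∈ D ∧ t - ε ≤ s₁ ∧ s₁ < s₂ ∧
      s₂ ≤ t + ε ∧ f.OnGraph x s₁ ∧ f.OnGraph y s₂) :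
    ∃ f ∈ A, f.initialTime ≤ t ∧ f (left t) ∈ C ∧ f (right t) ∈ D := by
  let F : {ε : ℝ // 0 < ε} → Set CadlagPath := fun ε =>
    {f | (f.interpolatedGraph₂ ∩ (SpaceTime.box C (t - ε) (t + ε) ×ˢ
      SpaceTime.box D (t - ε) (t + ε))).Nonempty}
  have hne : (A ∩ ⋂ ε, F ε).Nonempty := by
    by_contra hempty
    have : Nonempty {ε : ℝ // 0 < ε} := ⟨⟨1, one_pos⟩⟩
    obtain ⟨ε, hε⟩ := hc.elim_directed_family_closed F
      (fun ε => isClosed_setOf_interpolatedGraph₂_inter_nonempty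
        ((SpaceTime.isClosed_box hC _ _).prod (SpaceTime.isClosed_box hD _ _)))
      (not_nonempty_iff_eq_empty.1 hempty)
      (by
        have hmono : ∀ a b : {ε : ℝ // 0 < ε}, a.1 ≤ b.1 → F a ⊆ F b := by
          rintro ⟨a, ha⟩ ⟨b, hb⟩ hab f ⟨w, hw, ⟨x, hx, s, hs, h1⟩, ⟨y, hy, s', hs', h2⟩⟩
          simp only at hab hs hs'
          exact ⟨w, hw, ⟨x, hx, s, ⟨by linarith [hs.1], by linarith [hs.2]⟩, h1⟩,
            ⟨y, hy, s', ⟨by linarith [hs'.1], by linarith [hs'.2]⟩, h2⟩⟩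
        intro a b
        rcases le_total a.1 b.1 with h | h
        · exact ⟨a, Subset.rfl, hmono _ _ h⟩
        · exact ⟨b, hmono _ _ h, Subset.rfl⟩)
    obtain ⟨f, hf, x, y, s₁, s₂, hx, hy, h1, h2, h3, h4, h5⟩ := H ε.1 ε.2
    have : f ∈ A ∩ F ε := ⟨hf, (SpaceTime.mk x s₁, SpaceTime.mk y s₂),
      mk_mem_interpolatedGraph₂_iff.2 ⟨h4, h5, Or.inl h2⟩,
      ⟨x, hx, s₁, ⟨h1, by linarith⟩, rfl⟩, ⟨y, hy, s₂, ⟨by linarith, h3⟩, rfl⟩⟩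
    rw [hε] at this
    exact this
  obtain ⟨f, hf, hF⟩ := hne
  rw [mem_iInter] at hF
  exact ⟨f, hf, (hA f hf).mem_of_forall_interpolatedGraph₂ hC hD hCD hC' hD'
    fun ε hε => hF ⟨ε, hε⟩⟩

end CadlagPath

/-! ### Jumps and pervasiveness in a weave -/

namespace IsDeterministicWeave

open CadlagPath

variable {f g h : CadlagPath} {A : Set CadlagPath} {p q : SplitReal} {t : ℝ} {x y a b : EReal}

theorem exists_jump_up (hA : IsDeterministicWeave A) (hab : a < b)
    (H : ∀ ε > 0, ∃ f ∈ A, ∃ (x y : EReal) (s₁ s₂ : ℝ), x ≤ a ∧ b ≤ y ∧ t - ε ≤ s₁ ∧ s₁ < s₂ ∧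
      s₂ ≤ t + ε ∧ f.OnGraph x s₁ ∧ f.OnGraph y s₂) :
    ∃ f ∈ A, f.initialTime ≤ t ∧ f (left t) ≤ a ∧ b ≤ f (right t) :=
  exists_jump hA.isHalfInfinite hA.isCompact (C := Iic a) (D := Ici b) isClosed_Iic isClosed_Ici
    (Set.disjoint_left.2 fun _ h1 h2 => absurd (h2.trans h1) (not_le.2 hab))
    (by rw [compl_Iic]; exact ordConnected_Ioi) (by rw [compl_Ici]; exact ordConnected_Iio) H

theorem exists_jump_down (hA : IsDeterministicWeave A) (hab : a < b)
    (H : ∀ ε > 0, ∃ f ∈ A, ∃ (x y : EReal) (s₁ s₂ : ℝ), b ≤ x ∧ y ≤ a ∧ t - ε ≤ s₁ ∧ s₁ < s₂ ∧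
      s₂ ≤ t + ε ∧ f.OnGraph x s₁ ∧ f.OnGraph y s₂) :
    ∃ f ∈ A, f.initialTime ≤ t ∧ b ≤ f (left t) ∧ f (right t) ≤ a :=
  exists_jump hA.isHalfInfinite hA.isCompact (C := Ici b) (D := Iic a) isClosed_Ici isClosed_Iic
    (Set.disjoint_left.2 fun _ h1 h2 => absurd (h1.trans h2) (not_le.2 hab))
    (by rw [compl_Ici]; exact ordConnected_Iio) (by rw [compl_Iic]; exact ordConnected_Ioi) H

theorem exists_mem_maximalPaths_isExtendedBy (hA : IsDeterministicWeave A) (hf : f ∈ A) :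
    ∃ g ∈ maximalPaths A, f.IsExtendedBy g :=
  exists_mem_maximalPaths hA.isHalfInfinite hA.isCompact hf

/-- Every real space-time point lies on a maximal path. -/
theorem exists_mem_maximalPaths_onGraph (hA : IsDeterministicWeave A) (x : EReal) (t : ℝ) :
    ∃ f ∈ maximalPaths A, f.OnGraph x t := by
  obtain ⟨f, hf, y, s, hy, hs⟩ := hA.pervasive (SpaceTime.mk x t)
  obtain ⟨rfl, hxy⟩ := SpaceTime.mk_eq_mk_iff.1 hs
  obtain rfl : x = y := by simpa using hxy
  obtain ⟨g, hg, hfg⟩ := hA.exists_mem_maximalPaths_isExtendedBy hf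
  refine ⟨g, hg, ?_⟩
  exact (mk_mem_interpolatedGraph₂_iff.1 (hfg (mk_mem_interpolatedGraph₂_iff.2
    ⟨hy, hy, Or.inr ⟨rfl, right_mem_uIcc⟩⟩))).1

end IsDeterministicWeave

namespace SplitReal

variable {p : SplitReal} {s t : ℝ}

theorem lt_of_right_lt_left (h : right s < left t) : s < t := by
  by_contra hst
  rcases (not_lt.1 hst).lt_or_eq with h1 | h1
  · exact lt_asymm h (lt_of_time_lt (p := left t) (q := right s) h1)
  · rw [h1] at h
    exact lt_asymm h (left_lt_right _)

theorem time_lt_of_lt_left (h : p < left t) : p.time < t := by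
  refine (time_le_of_le h.le).lt_of_ne fun h1 => ?_
  rw [time_left] at h1
  rcases eq_left_or_eq_right p with hp | hp <;> rw [hp, h1] at h
  · exact lt_irrefl _ h
  · exact lt_asymm h (left_lt_right _)

end SplitReal

/-! ### Graph points, envelopes and the right boundary -/

namespace CadlagPath

variable {f g h : CadlagPath} {A X : Set CadlagPath} {p q : SplitReal} {t : ℝ}
  {x y a b c : EReal}

theorem IsHalfInfinite.onGraph_apply (hf : f.IsHalfInfinite)
    (hp : f.initialTime ≤ (p.time : EReal)) : f.OnGraph (f p) p.time := by
  refine hf.onGraph_coe_iff.2 ⟨hp, ?_⟩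
  rcases eq_left_or_eq_right p with h | h
  · rw [← h]
    exact left_mem_uIcc
  · rw [← h]
    exact right_mem_uIcc

/-- The upper endpoint of a jump always lies on the lower envelope, even at the initial time: that
envelope keeps `f(σ-)` precisely when the initial jump is downward. -/
theorem OnGraph.le_lower (hf : f.IsHalfInfinite) (hx : f.OnGraph x t) :
    x ≤ f.lower (left t) ∨ x ≤ f.lower (right t) := by
  obtain ⟨hi, hx⟩ := hf.onGraph_coe_iff.1 hx
  rw [lower_right hi]
  rcases le_or_gt (f (left t)) (f (right t)) with h | h
  · rw [uIcc_of_le h] at hx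
    exact Or.inr hx.2
  · rw [uIcc_of_ge h.le] at hx
    rw [lower_left hi h]
    exact Or.inl hx.2

theorem OnGraph.upper_le (hf : f.IsHalfInfinite) (hx : f.OnGraph x t) :
    f.upper (left t) ≤ x ∨ f.upper (right t) ≤ x := by
  obtain ⟨hi, hx⟩ := hf.onGraph_coe_iff.1 hx
  rw [upper_right hi]
  rcases le_or_gt (f (right t)) (f (left t)) with h | h
  · rw [uIcc_of_ge h] at hx
    exact Or.inr hx.1
  · rw [uIcc_of_le h.le] at hx
    rw [upper_left hi h]
    exact Or.inl hx.1

theorem OnGraph.not_liesLeftOf (hf : f.IsHalfInfinite) (hh : h.IsHalfInfinite)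
    (hx : f.OnGraph x t) (hl : x < h.lower (left t)) (hr : x < h.lower (right t)) :
    ¬ h.LiesLeftOf f := by
  rw [hh.liesLeftOf_iff hf]
  intro hle
  rcases hx.upper_le hf with h1 | h1
  · exact absurd hl (not_lt.2 ((hle _).trans h1))
  · exact absurd hr (not_lt.2 ((hle _).trans h1))

theorem OnGraph.not_liesLeftOf' (hf : f.IsHalfInfinite) (hh : h.IsHalfInfinite)
    (hx : f.OnGraph x t) (hl : h.upper (left t) < x) (hr : h.upper (right t) < x) :
    ¬ f.LiesLeftOf h := by
  rw [hf.liesLeftOf_iff hh]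
  intro hle
  rcases hx.le_lower hf with h1 | h1
  · exact absurd hl (not_lt.2 (h1.trans (hle _)))
  · exact absurd hr (not_lt.2 (h1.trans (hle _)))

/-- A path that lies to the right of `f` and that has started before `p`, is above the lower envelope
of `f` at `p`. -/
theorem LiesLeftOf.lower_le (hf : f.IsHalfInfinite) (hg : g.IsHalfInfinite) (hfg : f.LiesLeftOf g)
    (hp : g.IsStarted p) : f.lower p ≤ g p := by
  rw [← hp.upper_eq]
  exact (hf.liesLeftOf_iff hg).1 hfg p

theorem LiesLeftOf.le_upper (hf : f.IsHalfInfinite) (hg : g.IsHalfInfinite) (hfg : f.LiesLeftOf g)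
    (hp : f.IsStarted p) : f p ≤ g.upper p := by
  rw [← hp.lower_eq]
  exact (hf.liesLeftOf_iff hg).1 hfg p

/-- Together with its converse below, this describes `rightBoundary X` as the limit superior at `p`
of the supremum of the lower envelopes of the paths in `X`. Upper semicontinuity follows for
arbitrary `X`. -/
theorem frequently_of_lt_rightBoundary (hx : x < rightBoundary X p) :
    ∃ᶠ q in 𝓝 p, ∃ f ∈ X, x < f.lower q := by
  obtain ⟨y, hy, hxy⟩ := lt_sSup_iff.1 hx
  rw [Filter.frequently_iff]
  intro N hN
  obtain ⟨⟨z, q⟩, ⟨hz, hq⟩, h⟩ := mem_closure_iff_nhds.1 hy _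
    (prod_mem_nhds (Ioi_mem_nhds hxy) hN)
  simp only [mem_iUnion] at h
  obtain ⟨f, hf, h⟩ := h
  exact ⟨q, hq, f, hf, lt_trans hz (mem_leftRegion_iff.1 h)⟩

theorem le_rightBoundary_of_frequently (hx : ∃ᶠ q in 𝓝 p, ∃ f ∈ X, x < f.lower q) :
    x ≤ rightBoundary X p := by
  refine le_sSup (mem_closure_iff_nhds.2 fun U hU => ?_)
  rw [nhds_prod_eq] at hU
  obtain ⟨V, hV, N, hN, hVN⟩ := Filter.mem_prod_iff.1 hU
  obtain ⟨q, hq, f, hf, hlt⟩ := Filter.frequently_iff.1 hx hN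
  refine ⟨(x, q), hVN ⟨mem_of_mem_nhds hV, hq⟩, ?_⟩
  simp only [mem_iUnion]
  exact ⟨f, hf, mem_leftRegion_iff.2 hlt⟩

theorem eventually_of_rightBoundary_lt (hx : rightBoundary X p < x) :
    ∀ᶠ q in 𝓝 p, ∀ f ∈ X, f.lower q ≤ x := by
  by_contra hfr
  refine absurd (le_rightBoundary_of_frequently ?_) (not_le.2 hx)
  refine (Filter.not_eventually.1 hfr).mono fun q hq => ?_
  push Not at hq
  exact hq

theorem lower_le_rightBoundary (hf : f ∈ X) (p : SplitReal) : f.lower p ≤ rightBoundary X p := by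
  refine le_of_forall_lt fun x hx => ?_
  obtain ⟨y, hxy, hy⟩ := exists_between hx
  exact hxy.trans_le (le_rightBoundary_of_frequently (Filter.frequently_iff.2 fun hU =>
    ⟨p, mem_of_mem_nhds hU, f, hf, hy⟩))

theorem eventually_rightBoundary_lt (hx : rightBoundary X p < x) :
    ∀ᶠ q in 𝓝 p, rightBoundary X q < x := by
  obtain ⟨y, hy, hyx⟩ := exists_between hx
  filter_upwards [(eventually_of_rightBoundary_lt hy).eventually_nhds] with q hq
  refine lt_of_le_of_lt (not_lt.1 fun hlt => ?_) hyx
  obtain ⟨q', ⟨f, hf, h1⟩, h2⟩ := ((frequently_of_lt_rightBoundary hlt).and_eventually hq).exists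
  exact absurd h1 (not_lt.2 (h2 f hf))

theorem exists_between_of_rightBoundary_lt {u v : ℝ} (hu : right u < q) (hv : q < left v)
    (hx : rightBoundary X q < x) :
    ∃ s, u < s ∧ s < v ∧ ∀ f ∈ X, f.lower (left s) ≤ x ∧ f.lower (right s) ≤ x := by
  obtain ⟨s, ⟨h1, h2⟩, h3, h4⟩ := exists_left_right_mem
    (Filter.inter_mem (eventually_of_rightBoundary_lt hx) (Ioo_mem_nhds hu hv))
  exact ⟨s, lt_of_right_lt_left h2.1, lt_of_right_lt_left h4.2, fun f hf => ⟨h1 f hf, h3 f hf⟩⟩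

/-- A continuous function on the split real line, seen as a bi-infinite path. -/
noncomputable def ofContinuous (φ : SplitReal → EReal) (hφ : Continuous φ) : CadlagPath where
  initialTime := ⊥
  finalTime := ⊤
  initialTime_le_finalTime := bot_le
  toFun := φ
  continuousOn_toFun := hφ.continuousOn
  toFun_eq_bot _ hp := absurd ⟨bot_le, le_top⟩ hp

theorem ofContinuous_isBiInfinite (φ : SplitReal → EReal) (hφ : Continuous φ) :
    (ofContinuous φ hφ).IsBiInfinite := ⟨rfl, rfl⟩

theorem IsBiInfinite.ext (hf : f.IsBiInfinite) (hg : g.IsBiInfinite) (hfg : ∀ p, f p = g p) :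
    f = g :=
  CadlagPath.ext (hf.1.trans hg.1.symm) (hf.2.trans hg.2.symm) (funext hfg)

end CadlagPath

/-! ### Continuity of the right boundary -/

namespace IsDeterministicWeave

open CadlagPath

variable {f g h : CadlagPath} {A X : Set CadlagPath} {p q : SplitReal} {t : ℝ}
  {x y a b c : EReal}

/-- If paths of `X` are above `b`, shortly after times at which all paths of `X` are below `a < b`,
then the paths to the right of `X` have to jump upwards in the limit. -/
theorem exists_jump_up_of_oscillation (hA : IsDeterministicWeave A) (hX : X ⊆ maximalPaths A)
    (hsep : ∀ f ∈ X, ∀ g ∈ maximalPaths A, g ∉ X → f.LiesLeftOf g) (hac : a < c) (hcb : c < b)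
    (H : ∀ ε > 0, ∃ s r, t - ε ≤ s ∧ s < r.time ∧ r.time ≤ t + ε ∧
      (∀ f ∈ X, f.lower (left s) ≤ a ∧ f.lower (right s) ≤ a) ∧ ∃ f ∈ X, b ≤ f.lower r) :
    ∃ g ∈ A, g.initialTime ≤ t ∧ g (left t) ≤ c ∧ b ≤ g (right t) := by
  refine hA.exists_jump_up hcb fun ε hε => ?_
  obtain ⟨s, r, h1, h2, h3, h4, f, hf, hbf⟩ := H ε hε
  obtain ⟨g, hg, hgs⟩ := hA.exists_mem_maximalPaths_onGraph c s
  -- All paths of `X` are below `a < c` at both parts of `s`, so the path through `(c, s)` is not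
  -- one of them. It therefore lies to the right of `X` and is pushed up to `b` by time `r`.
  have hgX : g ∉ X := by
    intro hgX
    rcases hgs.le_lower (hA.isHalfInfinite g hg.1) with h | h
    · exact absurd hac (not_lt.2 (h.trans (h4 g hgX).1))
    · exact absurd hac (not_lt.2 (h.trans (h4 g hgX).2))
  have hg' := hA.isHalfInfinite g hg.1
  have hgi : g.initialTime < (r.time : EReal) :=
    (hg'.onGraph_coe_iff.1 hgs).1.trans_lt (by exact_mod_cast h2)
  exact ⟨g, hg.1, c, g r, s, r.time, le_rfl,
    hbf.trans ((hsep f hf g hg hgX).lower_le (hA.isHalfInfinite f (hX hf).1) hg' (Or.inl hgi)),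
    h1, h2, h3, hgs, hg'.onGraph_apply hgi.le⟩

/-- Here the paths of `X` suffice: one that is above `b` at `r` has started by then, so it is itself
subject to the bound `a` at the later time `s`. -/
theorem exists_jump_down_of_oscillation (hA : IsDeterministicWeave A) (hX : X ⊆ maximalPaths A)
    (hab : a < b)
    (H : ∀ ε > 0, ∃ s r, t - ε ≤ r.time ∧ r.time < s ∧ s ≤ t + ε ∧
      (∀ f ∈ X, f.lower (left s) ≤ a ∧ f.lower (right s) ≤ a) ∧ ∃ f ∈ X, b < f.lower r) :
    ∃ f ∈ A, f.initialTime ≤ t ∧ b ≤ f (left t) ∧ f (right t) ≤ a := by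
  refine hA.exists_jump_down hab fun ε hε => ?_
  obtain ⟨s, r, h1, h2, h3, h4, f, hf, hbf⟩ := H ε hε
  have hf' := hA.isHalfInfinite f (hX hf).1
  have hi := initialTime_le_of_lt_lower hbf
  have his : f.initialTime < (s : EReal) := hi.trans_lt (by exact_mod_cast h2)
  refine ⟨f, (hX hf).1, f r, f (left s), r.time, s, (hbf.trans_le (lower_le f r)).le, ?_,
    h1, h2, h3, hf'.onGraph_apply hi, hf'.onGraph_apply (p := left s) his.le⟩
  rw [← (isStarted_left his).lower_eq]
  exact (h4 f hf).1

theorem not_oscillation (hA : IsDeterministicWeave A) (hX : X ⊆ maximalPaths A)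
    (hsep : ∀ f ∈ X, ∀ g ∈ maximalPaths A, g ∉ X → f.LiesLeftOf g) (hab : a < b)
    (H₁ : ∀ ε > 0, ∃ s r, t - ε ≤ s ∧ s < r.time ∧ r.time ≤ t + ε ∧
      (∀ f ∈ X, f.lower (left s) ≤ a ∧ f.lower (right s) ≤ a) ∧ ∃ f ∈ X, b < f.lower r)
    (H₂ : ∀ ε > 0, ∃ s r, t - ε ≤ r.time ∧ r.time < s ∧ s ≤ t + ε ∧
      (∀ f ∈ X, f.lower (left s) ≤ a ∧ f.lower (right s) ≤ a) ∧ ∃ f ∈ X, b < f.lower r) :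
    False := by
  obtain ⟨c, hac, hcb⟩ := exists_between hab
  obtain ⟨g, hg, hgi, hgl, hgr⟩ := hA.exists_jump_up_of_oscillation hX hsep hac hcb
    fun ε hε => by
      obtain ⟨s, r, h1, h2, h3, h4, f, hf, hbf⟩ := H₁ ε hε
      exact ⟨s, r, h1, h2, h3, h4, f, hf, hbf.le⟩
  obtain ⟨f, hf, hfi, hfl, hfr⟩ := hA.exists_jump_down_of_oscillation hX hab H₂
  exact (hA.nonCrossing f hf g hg).false_of_opposite_jumps (hA.isHalfInfinite f hf)
    (hA.isHalfInfinite g hg) hfi hgi ((hfr.trans_lt hab).trans_le hfl)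
    ((hgl.trans_lt hcb).trans_le hgr) ((hgl.trans_lt hcb).trans_le hfl)
    ((hfr.trans_lt hab).trans_le hgr)

/-- Lower semicontinuity is the substantial half of continuity. Where it fails, the boundary takes
low values arbitrarily close to `p` while paths of `X` are high there, which leads to opposite
jumps. -/
theorem eventually_lt_rightBoundary (hA : IsDeterministicWeave A) (hX : X ⊆ maximalPaths A)
    (hsep : ∀ f ∈ X, ∀ g ∈ maximalPaths A, g ∉ X → f.LiesLeftOf g) (hx : x < rightBoundary X p) :
    ∀ᶠ q in 𝓝 p, x < rightBoundary X q := by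
  by_contra hfr
  have hfr : ∃ᶠ q in 𝓝 p, rightBoundary X q ≤ x :=
    (Filter.not_eventually.1 hfr).mono fun q hq => not_lt.1 hq
  obtain ⟨b, hxb, hb⟩ := exists_between hx
  obtain ⟨a, hxa, hab⟩ := exists_between hxb
  have hfr_ne : ∀ q, rightBoundary X q ≤ x → q ≠ p := by
    rintro q hq rfl
    exact absurd hx (not_lt.2 hq)
  rcases eq_left_or_eq_right p with hp | hp <;> generalize p.time = t at hp <;> subst hp
  · have hlow : ∀ ε > 0, ∃ s, t - ε < s ∧ s < t ∧
        ∀ f ∈ X, f.lower (left s) ≤ a ∧ f.lower (right s) ≤ a := by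
      intro ε hε
      obtain ⟨q, hq, h1, h2⟩ := (hfr.and_eventually (nhds_left_mem hε)).exists
      have h3 : q < left t := lt_of_le_of_ne h2 (hfr_ne q hq)
      obtain ⟨s, h4, h5, h6⟩ := exists_between_of_rightBoundary_lt
        (lt_of_time_lt (p := right (t - ε)) h1) h3 (hq.trans_lt hxa)
      exact ⟨s, h4, h5, h6⟩
    by_cases hup : ∀ ε > 0, ∃ r : SplitReal, t - ε < r.time ∧ r.time < t ∧ ∃ f ∈ X, b < f.lower r
    · refine hA.not_oscillation (t := t) hX hsep hab (fun ε hε => ?_) fun ε hε => ?_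
      · obtain ⟨s, h1, h2, h3⟩ := hlow ε hε
        obtain ⟨r, h4, h5, h6⟩ := hup (t - s) (by linarith)
        exact ⟨s, r, h1.le, by linarith, by linarith, h3, h6⟩
      · obtain ⟨r, h4, h5, h6⟩ := hup ε hε
        obtain ⟨s, h1, h2, h3⟩ := hlow (t - r.time) (by linarith)
        exact ⟨s, r, h4.le, by linarith, by linarith, h3, h6⟩
    -- No path of `X` is high shortly before `t`, so the high value occurs at `t-` itself, on a path
    -- `f` that starts there with a downward jump. The opposite upward jump is then made to reach
    -- `f(t-)`.
    · push Not at hup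
      obtain ⟨ε, hε, hup⟩ := hup
      obtain ⟨q, ⟨f, hf, hbf⟩, h1, h2⟩ := ((frequently_of_lt_rightBoundary hb).and_eventually
        (nhds_left_mem hε)).exists
      have hq : q = left t := by
        by_contra hne
        exact absurd hbf (not_lt.2 (hup q h1 (time_lt_of_lt_left (lt_of_le_of_ne h2 hne)) f hf))
      subst hq
      have hf' := hA.isHalfInfinite f (hX hf).1
      rcases hf'.eventually_lt_lower hbf with hev | ⟨t', hi, ht', hj⟩
      · obtain ⟨s, h3, h4, h5, -⟩ := exists_lt_of_mem_nhds_left hε hev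
        exact absurd h5 (not_lt.2 (hup (left s) h3 h4 f hf))
      · obtain rfl : t = t' := congrArg time ht'
        rw [lower_left hi.le hj] at hbf
        obtain ⟨c, hac, hcb⟩ := exists_between hab
        obtain ⟨g, hg, hgi, hgl, hgr⟩ := hA.exists_jump_up_of_oscillation (t := t) (b := f (left t))
          hX hsep hac (hcb.trans hbf) fun ε hε => by
            obtain ⟨s, h1, h2, h3⟩ := hlow ε hε
            exact ⟨s, left t, h1.le, h2, by simp only [time_left]; linarith, h3, f, hf,
              (lower_left hi.le hj).ge⟩
        have hgc := hgl.trans_lt (hcb.trans hbf)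
        exact (hA.nonCrossing f (hX hf).1 g hg).false_of_opposite_jumps hf'
          (hA.isHalfInfinite g hg) hi.le hgi hj (hgc.trans_le hgr) hgc (hj.trans_le hgr)
  · have hlow : ∀ ε > 0, ∃ s, t < s ∧ s < t + ε ∧
        ∀ f ∈ X, f.lower (left s) ≤ a ∧ f.lower (right s) ≤ a := by
      intro ε hε
      obtain ⟨q, hq, h1, h2⟩ := (hfr.and_eventually (nhds_right_mem hε)).exists
      have h3 : right t < q := lt_of_le_of_ne h2 (hfr_ne q hq).symm
      obtain ⟨s, h4, h5, h6⟩ := exists_between_of_rightBoundary_lt h3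
        (lt_of_time_lt (q := left (t + ε)) h1) (hq.trans_lt hxa)
      exact ⟨s, h4, h5, h6⟩
    -- On this side a high value at `t+` spreads to later times by continuity, so the exceptional
    -- case does not arise.
    have hup : ∀ ε > 0, ∃ r : SplitReal, t < r.time ∧ r.time < t + ε ∧ ∃ f ∈ X, b < f.lower r := by
      intro ε hε
      obtain ⟨q, ⟨f, hf, hbf⟩, h1, h2⟩ := ((frequently_of_lt_rightBoundary hb).and_eventually
        (nhds_right_mem hε)).exists
      rcases right_le_iff.1 h2 with h3 | rfl
      · exact ⟨q, h3, h1, f, hf, hbf⟩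
      · rcases (hA.isHalfInfinite f (hX hf).1).eventually_lt_lower hbf with hev | ⟨t', -, ht', -⟩
        · obtain ⟨s, h3, h4, h5, -⟩ := exists_gt_of_mem_nhds_right hε hev
          exact ⟨left s, h3, h4, f, hf, h5⟩
        · obtain rfl : t = t' := congrArg time ht'
          exact absurd ht'.symm (left_ne_right t)
    refine hA.not_oscillation (t := t) hX hsep hab (fun ε hε => ?_) fun ε hε => ?_
    · obtain ⟨r, h4, h5, h6⟩ := hup ε hε
      obtain ⟨s, h1, h2, h3⟩ := hlow (r.time - t) (by linarith)
      exact ⟨s, r, by linarith, by linarith, h5.le, h3, h6⟩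
    · obtain ⟨s, h1, h2, h3⟩ := hlow ε hε
      obtain ⟨r, h4, h5, h6⟩ := hup (s - t) (by linarith)
      exact ⟨s, r, by linarith, by linarith, h2.le, h3, h6⟩

theorem continuous_rightBoundary (hA : IsDeterministicWeave A) (hX : X ⊆ maximalPaths A)
    (hsep : ∀ f ∈ X, ∀ g ∈ maximalPaths A, g ∉ X → f.LiesLeftOf g) :
    Continuous (rightBoundary X) :=
  continuous_iff_continuousAt.2 fun _ => tendsto_order.2
    ⟨fun _ hx => hA.eventually_lt_rightBoundary hX hsep hx, fun _ => eventually_rightBoundary_lt⟩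

/-- An upper bound valid for every path of `X` survives the closure wherever `g.upper` is upper
semicontinuous. The exception is `t-` when `g` starts at `t` with an upward jump: paths of `X` that
are too high just before `t` must be below `g(t-)` at `t-`, so in the limit some path of `A` jumps
down across `g`. -/
theorem rightBoundary_le_upper (hA : IsDeterministicWeave A) (hX : X ⊆ A)
    (hg : g.IsHalfInfinite) (hgA : ∀ f ∈ A, g.NonCrossing f) (hXg : ∀ f ∈ X, f.LiesLeftOf g)
    (p : SplitReal) : rightBoundary X p ≤ g.upper p := by
  by_contra hlt
  obtain ⟨b, hgb, hb⟩ := exists_between (not_le.1 hlt)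
  have hle : ∀ f ∈ X, ∀ q, f.lower q ≤ g.upper q := fun f hf =>
    ((hA.isHalfInfinite f (hX hf)).liesLeftOf_iff hg).1 (hXg f hf)
  rcases hg.eventually_upper_lt hgb with hev | ⟨t, hi, rfl, hj⟩
  · obtain ⟨q, ⟨f, hf, hbf⟩, h⟩ := ((frequently_of_lt_rightBoundary hb).and_eventually hev).exists
    exact absurd (hle f hf q) (not_le.2 (h.trans hbf))
  · rw [upper_left hi.le hj] at hgb
    obtain ⟨f, hf, hfi, hfl, hfr⟩ := hA.exists_jump_down (t := t) hgb fun ε hε => by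
      obtain ⟨q, ⟨f, hf, hbf⟩, h1, h2⟩ := ((frequently_of_lt_rightBoundary hb).and_eventually
        (nhds_left_mem hε)).exists
      have hf' := hA.isHalfInfinite f (hX hf)
      have hq : q < left t := by
        refine lt_of_le_of_ne h2 ?_
        rintro rfl
        have := hle f hf (left t)
        rw [upper_left hi.le hj] at this
        exact absurd (hbf.trans_le this) (lt_asymm hgb)
      have hqt := time_lt_of_lt_left hq
      have hfi := initialTime_le_of_lt_lower hbf
      have hfs : f.initialTime < (t : EReal) := hfi.trans_lt (by exact_mod_cast hqt)
      refine ⟨f, hX hf, f q, f (left t), q.time, t, (hbf.trans_le (lower_le f q)).le, ?_, h1.le,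
        hqt, by linarith, hf'.onGraph_apply hfi, hf'.onGraph_apply (p := left t) hfs.le⟩
      have := (hXg f hf).le_upper hf' hg (isStarted_left hfs)
      rwa [upper_left hi.le hj] at this
    have hlt := hgb.trans_le hfl
    exact (hgA f hf).symm.false_of_opposite_jumps (hA.isHalfInfinite f hf) hg hfi hi.le
      (hfr.trans_lt hlt) hj hlt (hfr.trans_lt hj)

theorem ofContinuous_rightBoundary_mem_flow (hA : IsDeterministicWeave A) (hX : X ⊆ maximalPaths A)
    (hsep : ∀ f ∈ X, ∀ g ∈ maximalPaths A, g ∉ X → f.LiesLeftOf g)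
    (hc : Continuous (rightBoundary X)) :
    ofContinuous (rightBoundary X) hc ∈ flow A ∧
      ∀ f ∈ maximalPaths A, (f ∈ X → f.LiesLeftOf (ofContinuous (rightBoundary X) hc)) ∧
        (f ∉ X → (ofContinuous (rightBoundary X) hc).LiesLeftOf f) := by
  have hbi := ofContinuous_isBiInfinite (rightBoundary X) hc
  have key : ∀ f ∈ maximalPaths A, (f ∈ X → f.LiesLeftOf (ofContinuous (rightBoundary X) hc)) ∧
      (f ∉ X → (ofContinuous (rightBoundary X) hc).LiesLeftOf f) := by
    intro f hf
    have hf' := hA.isHalfInfinite f hf.1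
    constructor
    · intro hfX
      rw [hf'.liesLeftOf_iff hbi.isHalfInfinite, hbi.upper_eq]
      exact lower_le_rightBoundary hfX
    · intro hfX
      rw [hbi.isHalfInfinite.liesLeftOf_iff hf', hbi.lower_eq]
      exact hA.rightBoundary_le_upper (fun _ h => (hX h).1) hf' (hA.nonCrossing f hf.1)
        fun g hg => hsep g hg f hf hfX
  refine ⟨⟨hbi, fun f hf => ?_⟩, key⟩
  obtain ⟨g, hg, hfg⟩ := hA.exists_mem_maximalPaths_isExtendedBy hf
  by_cases hgX : g ∈ X
  · exact Or.inr (((key g hg).1 hgX).of_isExtendedBy_left hfg)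
  · exact Or.inl (((key g hg).2 hgX).of_isExtendedBy_right hfg)

/-! ### The correspondence between flow and cuts -/

/-- Paths that lie on both sides of each other are related by extension, so the conditions defining
`X_h` collapse to a single one. -/
theorem mem_strictlyLeftPaths_iff (hA : IsDeterministicWeave A) (hh : h ∈ flow A) :
    f ∈ strictlyLeftPaths A h ↔ f ∈ maximalPaths A ∧ ¬ h.LiesLeftOf f := by
  constructor
  · rintro ⟨h1, h2, h3, h4⟩
    refine ⟨h1, fun h5 => ?_⟩
    rcases h2.isExtendedBy_or (hA.isHalfInfinite f h1.1) hh.1.isHalfInfinite h5 with h6 | h6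
    · exact h3 h6
    · exact h4 h6
  · rintro ⟨h1, h2⟩
    exact ⟨h1, (hh.2 f h1.1).resolve_left h2, fun h3 => h2 (h3.liesLeftOf' hh.1.isHalfInfinite),
      fun h3 => h2 (h3.liesLeftOf (hA.isHalfInfinite f h1.1))⟩

theorem eq_of_liesLeftOf (hA : IsDeterministicWeave A) (hf : f ∈ maximalPaths A)
    (hg : g ∈ maximalPaths A) (hfg : f.LiesLeftOf g) (hgf : g.LiesLeftOf f) : f = g := by
  rcases hfg.isExtendedBy_or (hA.isHalfInfinite f hf.1) (hA.isHalfInfinite g hg.1) hgf with h | h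
  · exact hf.2 g hg.1 h
  · exact (hg.2 f hf.1 h).symm

theorem rightBoundary_strictlyLeftPaths (hA : IsDeterministicWeave A) (hh : h ∈ flow A)
    (p : SplitReal) : rightBoundary (strictlyLeftPaths A h) p = h p := by
  apply le_antisymm
  · rw [← (hh.1.isStarted p).upper_eq]
    exact hA.rightBoundary_le_upper (fun f hf => hf.1.1) hh.1.isHalfInfinite hh.2
      (fun f hf => hf.2.1) p
  · refine le_of_forall_lt fun x hx => ?_
    -- The level `y` is where a path of the weave is picked. The room down to `z` makes its envelope
    -- strictly exceed `z`, and the room down to `x` absorbs the loss of strictness in the limit.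
    obtain ⟨z, hxz, hz⟩ := exists_between hx
    obtain ⟨y, hzy, hy⟩ := exists_between hz
    refine hxz.trans_le (le_rightBoundary_of_frequently (Filter.frequently_iff.2 fun {U} hU => ?_))
    obtain ⟨s, ⟨h1, h2⟩, h3, h4⟩ := exists_left_right_mem
      (Filter.inter_mem hU (hh.1.continuous.continuousAt.eventually_const_lt hy))
    obtain ⟨f, hf, hfs⟩ := hA.exists_mem_maximalPaths_onGraph y s
    have hf' := hA.isHalfInfinite f hf.1
    have hfX : f ∈ strictlyLeftPaths A h := by
      refine (hA.mem_strictlyLeftPaths_iff hh).2 ⟨hf, hfs.not_liesLeftOf hf'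
        hh.1.isHalfInfinite ?_ ?_⟩ <;> rwa [hh.1.lower_eq]
    rcases hfs.le_lower hf' with h5 | h5
    · exact ⟨_, h1, f, hfX, hzy.trans_le h5⟩
    · exact ⟨_, h3, f, hfX, hzy.trans_le h5⟩

/-- A maximal path through a point strictly between `f` and `h` belongs to `X_h` but is not to the
left of `f`. If the gap is only known at `t-`, where `f` starts with an upward jump, paths through
`(x, s)` with `s` increasing to `t` are used; were all of them to the left of `f`, a limiting
downward jump would cross `f`. -/
theorem exists_mem_strictlyLeftPaths (hA : IsDeterministicWeave A) (hh : h ∈ flow A)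
    (hf : f ∈ strictlyLeftPaths A h) : ∃ g ∈ strictlyLeftPaths A h, ¬ g.LiesLeftOf f := by
  have hhi := hh.1.isHalfInfinite
  obtain ⟨hfA, hhf⟩ := (hA.mem_strictlyLeftPaths_iff hh).1 hf
  have hf' := hA.isHalfInfinite f hfA.1
  have hle : ∃ p, f.upper p < h p := by
    rw [hhi.liesLeftOf_iff hf', hh.1.lower_eq] at hhf
    simpa using hhf
  obtain ⟨p, hp⟩ := hle
  obtain ⟨x, hfx, hxh⟩ := exists_between hp
  have hxh' := hh.1.continuous.continuousAt.eventually_const_lt hxh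
  have hmem : ∀ g ∈ maximalPaths A, ∀ s : ℝ, g.OnGraph x s → x < h (left s) → x < h (right s) →
      g ∈ strictlyLeftPaths A h := by
    intro g hg s hgs h1 h2
    refine (hA.mem_strictlyLeftPaths_iff hh).2 ⟨hg, hgs.not_liesLeftOf
      (hA.isHalfInfinite g hg.1) hhi ?_ ?_⟩ <;> rwa [hh.1.lower_eq]
  rcases hf'.eventually_upper_lt hfx with hev | ⟨t, hi, rfl, hj⟩
  · obtain ⟨s, ⟨h1, h2⟩, h3, h4⟩ := exists_left_right_mem (Filter.inter_mem hev hxh')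
    obtain ⟨g, hg, hgs⟩ := hA.exists_mem_maximalPaths_onGraph x s
    exact ⟨g, hmem g hg s hgs h2 h4, hgs.not_liesLeftOf' (hA.isHalfInfinite g hg.1) hf' h1 h3⟩
  · by_contra hno
    push Not at hno
    rw [upper_left hi.le hj] at hfx
    obtain ⟨g, hg, hgi, hgl, hgr⟩ := hA.exists_jump_down (t := t) hfx fun ε hε => by
      obtain ⟨s, h1, h2, h3, h4⟩ := exists_lt_of_mem_nhds_left hε hxh'
      obtain ⟨g, hg, hgs⟩ := hA.exists_mem_maximalPaths_onGraph x s
      have hg' := hA.isHalfInfinite g hg.1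
      have hgi : g.initialTime < (t : EReal) :=
        (hg'.onGraph_coe_iff.1 hgs).1.trans_lt (by exact_mod_cast h2)
      have := (hno g (hmem g hg s hgs h3 h4)).le_upper hg' hf' (isStarted_left hgi)
      rw [upper_left hi.le hj] at this
      exact ⟨g, hg.1, x, g (left t), s, t, le_rfl, this, h1.le, h2, by linarith, hgs,
        hg'.onGraph_apply (p := left t) hgi.le⟩
    have hlt := hfx.trans_le hgl
    exact (hA.nonCrossing g hg f hfA.1).false_of_opposite_jumps (hA.isHalfInfinite g hg) hf'
      hgi hi.le (hgr.trans_lt hlt) hj hlt (hgr.trans_lt hj)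

theorem strictlyLeftPaths_mem_dedekindCuts (hA : IsDeterministicWeave A) (hh : h ∈ flow A) :
    strictlyLeftPaths A h ∈ dedekindCuts A := by
  refine ⟨fun f hf => hf.1, fun f hf g hg hfg => ?_, ?_⟩
  · by_contra hfX
    have hhf : h.LiesLeftOf f := by
      by_contra hhf
      exact hfX ((hA.mem_strictlyLeftPaths_iff hh).2 ⟨hf, hhf⟩)
    have hgf := hg.2.1.trans_isBiInfinite (hA.isHalfInfinite g hg.1.1) hh.1
      (hA.isHalfInfinite f hf.1) hhf
    exact hfX (hA.eq_of_liesLeftOf hf hg.1 hfg hgf ▸ hg)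
  · rintro ⟨m, hm, hmax⟩
    obtain ⟨g, hg, hgm⟩ := hA.exists_mem_strictlyLeftPaths hh hm
    have hmg := (hA.nonCrossing g hg.1.1 m hm.1.1).resolve_left hgm
    rw [hmax g hg hmg] at hgm
    exact hgm (LiesLeftOf.refl (hA.isHalfInfinite m hm.1.1))

theorem liesLeftOf_of_mem_dedekindCuts (hA : IsDeterministicWeave A) (hX : X ∈ dedekindCuts A)
    (hf : f ∈ X) (hg : g ∈ maximalPaths A) (hgX : g ∉ X) : f.LiesLeftOf g :=
  (hA.nonCrossing f (hX.1 hf).1 g hg.1).resolve_right fun h => hgX (hX.2.1 g hg f hf h)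

theorem strictlyLeftPaths_ofContinuous_rightBoundary (hA : IsDeterministicWeave A)
    (hX : X ∈ dedekindCuts A) (hc : Continuous (rightBoundary X)) :
    strictlyLeftPaths A (ofContinuous (rightBoundary X) hc) = X := by
  obtain ⟨hflow, hlr⟩ := hA.ofContinuous_rightBoundary_mem_flow hX.1
    (fun f hf g hg hgX => hA.liesLeftOf_of_mem_dedekindCuts hX hf hg hgX) hc
  ext f
  rw [hA.mem_strictlyLeftPaths_iff hflow]
  constructor
  · rintro ⟨hf, hfX⟩
    by_contra hn
    exact hfX ((hlr f hf).2 hn)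
  · intro hf
    -- A path of `X` with the boundary on its left would have all of `X` on its left, and so would
    -- be a maximal element of the cut.
    refine ⟨hX.1 hf, fun hle => hX.2.2 ⟨f, hf, fun g hg hfg => ?_⟩⟩
    refine Eq.symm (hA.eq_of_liesLeftOf (hX.1 hf) (hX.1 hg) hfg ?_)
    exact
      (((hlr g (hX.1 hg)).1 hg).trans_isBiInfinite (hA.isHalfInfinite g (hX.1 hg).1) hflow.1
        (hA.isHalfInfinite f (hX.1 hf).1) hle)

/-- Every half-infinite path that does not cross the weave is extended by a path of the flow. -/
theorem exists_mem_flow_isExtendedBy (hA : IsDeterministicWeave A) (hf : f.IsHalfInfinite)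
    (hfA : ∀ g ∈ A, f.NonCrossing g) : ∃ h ∈ flow A, f.IsExtendedBy h := by
  let X : Set CadlagPath := {g | g ∈ maximalPaths A ∧ ¬ f.LiesLeftOf g}
  have hXmax : X ⊆ maximalPaths A := fun g hg => hg.1
  have hXf : ∀ g ∈ X, g.LiesLeftOf f := fun g hg => (hfA g hg.1.1).resolve_left hg.2
  have hfX : ∀ g ∈ maximalPaths A, g ∉ X → f.LiesLeftOf g := by
    intro g hg hgX
    by_contra hfg
    exact hgX ⟨hg, hfg⟩
  have hsep : ∀ g ∈ X, ∀ k ∈ maximalPaths A, k ∉ X → g.LiesLeftOf k := by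
    intro g hg k hk hkX
    by_contra hgk
    have hkg := (hA.nonCrossing g hg.1.1 k hk.1).resolve_left hgk
    have hg' := hA.isHalfInfinite g hg.1.1
    have hk' := hA.isHalfInfinite k hk.1
    -- The paths `g`, `f`, `k` would form a cycle, so `f` would be extended by `g` or by `k`. Either
    -- way `f` would lie to the left of `g`, contrary to `g ∈ X`.
    rcases (hXf g hg).isExtendedBy_of_cycle hg' hf hk' (hfX k hk hkX) hkg hgk with h | h
    · exact hg.2 (h.liesLeftOf hg')
    · exact hg.2 (hkg.of_isExtendedBy_left h)
  have hc := hA.continuous_rightBoundary hXmax hsep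
  obtain ⟨hflow, hlr⟩ := hA.ofContinuous_rightBoundary_mem_flow hXmax hsep hc
  have hbi := hflow.1
  have hhf : (ofContinuous (rightBoundary X) hc).LiesLeftOf f := by
    rw [hbi.isHalfInfinite.liesLeftOf_iff hf, hbi.lower_eq]
    exact hA.rightBoundary_le_upper (fun g hg => hg.1.1) hf hfA hXf
  have hfh : f.LiesLeftOf (ofContinuous (rightBoundary X) hc) := by
    rw [hf.liesLeftOf_iff hbi.isHalfInfinite, hbi.upper_eq]
    intro p
    by_contra hlt
    change ¬ f.lower p ≤ rightBoundary X p at hlt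
    obtain ⟨x, hxr, hxf⟩ := exists_between (not_le.1 hlt)
    have hxr' := hc.continuousAt.eventually_lt_const hxr
    -- A path through a point in a gap between the boundary and `f` is not in `X`, so `f` must lie
    -- to its left, although the point is to the left of `f`.
    have hnX : ∀ g ∈ maximalPaths A, ∀ s : ℝ, g.OnGraph x s → rightBoundary X (left s) < x →
        rightBoundary X (right s) < x → g ∉ X := by
      intro g hg s hgs h1 h2 hgX
      rcases hgs.le_lower (hA.isHalfInfinite g hg.1) with h | h
      · exact absurd h1 (not_lt.2 (h.trans (lower_le_rightBoundary hgX _)))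
      · exact absurd h2 (not_lt.2 (h.trans (lower_le_rightBoundary hgX _)))
    rcases hf.eventually_lt_lower hxf with hev | ⟨t, hi, rfl, hj⟩
    · obtain ⟨s, ⟨h1, h2⟩, h3, h4⟩ := exists_left_right_mem (Filter.inter_mem hev hxr')
      obtain ⟨g, hg, hgs⟩ := hA.exists_mem_maximalPaths_onGraph x s
      exact hgs.not_liesLeftOf (hA.isHalfInfinite g hg.1) hf h1 h3
        (hfX g hg (hnX g hg s hgs h2 h4))
    · rw [lower_left hi.le hj] at hxf
      obtain ⟨g, hg, hgi, hgl, hgr⟩ := hA.exists_jump_up (t := t) hxf fun ε hε => by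
        obtain ⟨s, h1, h2, h3, h4⟩ := exists_lt_of_mem_nhds_left hε hxr'
        obtain ⟨g, hg, hgs⟩ := hA.exists_mem_maximalPaths_onGraph x s
        have hg' := hA.isHalfInfinite g hg.1
        have hgi : g.initialTime < (t : EReal) :=
          (hg'.onGraph_coe_iff.1 hgs).1.trans_lt (by exact_mod_cast h2)
        have := (hfX g hg (hnX g hg s hgs h3 h4)).lower_le hf hg' (isStarted_left hgi)
        rw [lower_left hi.le hj] at this
        exact ⟨g, hg.1, x, g (left t), s, t, le_rfl, this, h1.le, h2, by linarith, hgs,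
          hg'.onGraph_apply (p := left t) hgi.le⟩
      have hlt := hgl.trans_lt hxf
      exact (hfA g hg).false_of_opposite_jumps hf (hA.isHalfInfinite g hg) hi.le hgi hj
        (hlt.trans_le hgr) hlt (hj.trans_le hgr)
  refine ⟨_, hflow, ?_⟩
  rcases hfh.isExtendedBy_or hf hbi.isHalfInfinite hhf with h | h
  · exact h
  · rw [hbi.eq_of_isExtendedBy hf h]
    exact IsExtendedBy.refl f

end IsDeterministicWeave

theorem theorem4 (A : Set CadlagPath) (hA : IsDeterministicWeave A) :
    (Set.BijOn (strictlyLeftPaths A) (flow A) (dedekindCuts A) ∧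
      ∃ P : Set CadlagPath → CadlagPath,
        (∀ X ∈ dedekindCuts A, P X ∈ flow A ∧ ∀ p : SplitReal, P X p = rightBoundary X p) ∧
        Set.InvOn P (strictlyLeftPaths A) (flow A) (dedekindCuts A)) ∧
    (∀ f : CadlagPath, f.IsHalfInfinite → (∀ g ∈ A, f.NonCrossing g) →
      ∃ h ∈ flow A, f.IsExtendedBy h) := by
  classical
  have hsep : ∀ X ∈ dedekindCuts A, ∀ f ∈ X, ∀ g ∈ maximalPaths A, g ∉ X → f.LiesLeftOf g :=
    fun X hX f hf g hg hgX => hA.liesLeftOf_of_mem_dedekindCuts hX hf hg hgX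
  have hcont : ∀ X ∈ dedekindCuts A, Continuous (rightBoundary X) :=
    fun X hX => hA.continuous_rightBoundary hX.1 (hsep X hX)
  -- The default `const ⊥` is never used on a Dedekind cut, whose boundary is continuous.
  let P : Set CadlagPath → CadlagPath := fun X =>
    if hc : Continuous (rightBoundary X) then CadlagPath.ofContinuous _ hc else CadlagPath.const ⊥
  have hP : ∀ X (hX : X ∈ dedekindCuts A), P X = CadlagPath.ofContinuous _ (hcont X hX) :=
    fun X hX => dif_pos (hcont X hX)
  have hPflow : ∀ X ∈ dedekindCuts A, P X ∈ flow A := fun X hX => by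
    rw [hP X hX]
    exact (hA.ofContinuous_rightBoundary_mem_flow hX.1 (hsep X hX) _).1
  have hmaps : MapsTo (strictlyLeftPaths A) (flow A) (dedekindCuts A) :=
    fun h hh => hA.strictlyLeftPaths_mem_dedekindCuts hh
  have hinv : InvOn P (strictlyLeftPaths A) (flow A) (dedekindCuts A) := by
    constructor
    · intro h hh
      refine (hPflow _ (hmaps hh)).1.ext hh.1 fun p => ?_
      rw [hP _ (hmaps hh)]
      exact hA.rightBoundary_strictlyLeftPaths hh p
    · intro X hX
      rw [hP X hX]
      exact hA.strictlyLeftPaths_ofContinuous_rightBoundary hX _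
  refine ⟨⟨hinv.bijOn hmaps hPflow, P, fun X hX => ⟨hPflow X hX, fun p => ?_⟩, hinv⟩,
    fun f hf hfA => hA.exists_mem_flow_isExtendedBy hf hfA⟩
  rw [hP X hX]
  rfl
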